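/- For $t\in\mathbb R$ let $\operatorname{sgn}(t)=+1$ if $t>0$ and $\operatorname{sgn}(t)=-1$ if $t\le 0$. For $A\in\mathbb R^{m\times n}$ let $\Phi_A x=\operatorname{sgn}(Ax)\in\{\pm1\}^m$, with $\operatorname{sgn}$ applied componentwise. Let $\mathbb S^{n-1}_s$ be the set of $x\in\mathbb R^n$ with $\|x\|_2=1$ and at most $s$ nonzero coordinates, let $d_{\mathcal H^m}(a,b)=\frac1m|\{k: a_k\ne b_k\}|$ on $\{\pm1\}^m$, and let $d(x,y)=\frac1\pi\arccos\langle x,y\rangle$ on the unit sphere. Say that $\Phi_A$ has the $(s,\delta)$-RIP if $$\sup_{x,y\in\mathbb S^{n-1}_s}\bigl|d_{\mathcal H^m}(\Phi_Ax,\Phi_Ay)-d(x,y)\bigr|\le\delta .$$ **Theorem.** Let $A\in\mathbb R^{m\times n}$ be a random matrix whose rows are independent standard Gaussian vectors in $\mathbb R^n$. (i) There is an absolute constant $C>0$ such that for all $0<\varepsilon,\delta<1$ and all integers $1\le s<n$, $\Phi_A$ has the $(s,\delta)$-RIP with probability at least $1-\varepsilon$ provided $$m\ge C\,\delta^{-2}\bigl[\log(2/\varepsilon)+s\log(en/s)\bigr].$$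 (ii) For every $\theta\in(0,1)$ there is a constant $C_\theta>0$, depending only on $\theta$, such that for all $0<\varepsilon,\delta<1$ and all integers $1\le s\le\theta n$, $\Phi_A$ has the $(s,\delta)$-RIP with probability at least $1-\varepsilon$ provided $$m\ge C_\theta\,\delta^{-2}\bigl[\log(2/\varepsilon)+s\log(n/s)\bigr].$$ -/

import Mathlib

open MeasureTheory ProbabilityTheory

universe u

noncomputable section

namespace OneBit

/-- The sign convention of one-bit sensing: `+1` for `t > 0` and `-1` for `t ≤ 0`. The units of `ℤ`
are exactly `{1, -1}`. -/
def sgn (t : ℝ) : ℤˣ := if 0 < t then 1 else -1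

/-- The Hamming cube `{±1}^m`. -/
abbrev HammingCube (m : ℕ) : Type := Fin m → ℤˣ

/-- The normalized Hamming distance `(1/m) |{k : a k ≠ b k}|`. -/
def cubeDist {m : ℕ} (a b : HammingCube m) : ℝ := (hammingDist a b : ℝ) / m

/-- The unit-length `s`-sparse vectors of `ℝⁿ`: at most `s` nonzero coordinates. -/
def sparseSphere (n s : ℕ) : Set (EuclideanSpace ℝ (Fin n)) :=
  {x | ‖x‖ = 1 ∧ (Finset.univ.filter fun j => x j ≠ 0).card ≤ s}

/-- Geodesic distance on the unit sphere, normalized so that antipodal points are at distance 1. -/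
def geoDist {n : ℕ} (x y : EuclideanSpace ℝ (Fin n)) : ℝ :=
  Real.arccos (inner ℝ x y) / Real.pi

/-- The sign-linear map `x ↦ sgn (A x)`, with `sgn` applied componentwise. -/
def signLinear {m n : ℕ} (A : Matrix (Fin m) (Fin n) ℝ) (x : EuclideanSpace ℝ (Fin n)) :
    HammingCube m :=
  fun k => sgn (A.mulVec x.ofLp k)

/-- The one-bit `(s, δ)`-restricted isometry property of a map from the sparse sphere to the cube:
the supremum over all pairs of the deviation between the two distances is at most `δ`. -/
def HasRIP {m n : ℕ} (s : ℕ) (δ : ℝ) (Φ : sparseSphere n s → HammingCube m) : Prop :=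
  ∀ x y : sparseSphere n s, |cubeDist (Φ x) (Φ y) - geoDist x.1 y.1| ≤ δ

/-- A random matrix whose rows are independent standard Gaussian vectors of `ℝⁿ`. -/
structure IsStdGaussianMatrix {Ω : Type*} [MeasurableSpace Ω] {m n : ℕ}
    (A : Ω → Matrix (Fin m) (Fin n) ℝ) (P : Measure Ω) : Prop where
  hasLaw_row : ∀ k : Fin m,
    HasLaw (fun ω => WithLp.toLp 2 (A ω k)) (stdGaussian (EuclideanSpace ℝ (Fin n))) P
  indep_rows :
    iIndepFun (fun (k : Fin m) ω => (WithLp.toLp 2 (A ω k) : EuclideanSpace ℝ (Fin n))) P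

/-- With probability at least `1 - ε`, the sign-linear map of the random matrix `A` has the
`(s, δ)`-RIP. As the RIP is a condition on uncountably many pairs, this asks for a measurable event
of probability at least `1 - ε` on which it holds. -/
def RIPWithProb {Ω : Type*} [MeasurableSpace Ω] {m n : ℕ}
    (A : Ω → Matrix (Fin m) (Fin n) ℝ) (P : Measure Ω) (s : ℕ) (δ ε : ℝ) : Prop :=
  ∃ E : Set Ω, MeasurableSet E ∧ ENNReal.ofReal (1 - ε) ≤ P E ∧
    ∀ ω ∈ E, HasRIP s δ (fun x : sparseSphere n s => signLinear (A ω) x.1)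

end OneBit

end

namespace OneBit

/-! ### Chernoff and Bernstein bounds for sums over independent copies -/

section Tails

variable {Ω 𝓧 : Type*} [MeasurableSpace Ω] [MeasurableSpace 𝓧] {P : Measure Ω} {μ : Measure 𝓧}
  {m : ℕ} {X : Fin m → Ω → 𝓧}

/-! A random Gaussian hyperplane separates two unit vectors with probability angle/π
(`integral_signDiff`), so for fixed `x`, `y` the Hamming distance is an average of `m` independent
Bernoulli variables with mean `geoDist x y`. The task is to make the concentration uniform over the
sparse sphere without a factor `log (1/δ)`, which a union bound over a single fine net would cost.

The gain comes from chaining with Bernstein's inequality. When a pair moves by at most `v` in each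
entry, the change of the separation indicator has second moment at most `v` (`sq_signDiff_sub_le`,
`geoDist_le`). With `δ = 4⁻ᴶ`, nets of radius `8⁻ʲ/256` and allowed increments `δ 2⁻ʲ/64`, the
exponent is `m δ² 2ʲ/128`, while the log-cardinality of the nets grows only like `D (8 + 3j)`, where
`D` is the complexity in the hypothesis. Hence `m δ² ≥ 6000 D` serves all levels at once.

Signs are discontinuous, so the chain cannot run forever; it stops at level `J`, up to which the
sub-Gaussian range of Bernstein's inequality suffices. The remaining error is handled
deterministically: a sign change between `x` and its net point `y` needs either `|⟨y, g⟩| ≤ τ`, rare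
uniformly over the net, or `|⟨x - y, g⟩| > τ`, which is rare by a sparse operator norm bound
(`signDiff_le_slab_add`, `sum_inner_sq_le_of_net`). `abs_deviation_le_of_nets` is this deterministic
argument and `ripWithProb_dyadic` bounds the probability that its hypotheses fail. -/

theorem integrable_exp_mul_sum_of_aemeasurable {ι : Type*} {Y : ι → Ω → ℝ} {t : ℝ}
    (hind : iIndepFun Y P) (hmeas : ∀ i, AEMeasurable (Y i) P)
    (hint : ∀ i, Integrable (fun ω => Real.exp (t * Y i ω)) P) (s : Finset ι) :
    Integrable (fun ω => Real.exp (t * (∑ i ∈ s, Y i) ω)) P := by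
  classical
  have : IsProbabilityMeasure P := hind.isProbabilityMeasure
  induction s using Finset.induction_on with
  | empty => simp
  | insert i s hi ih =>
    rw [Finset.sum_insert hi]
    exact IndepFun.integrable_exp_mul_add
      (hind.indepFun_finsetSum_of_notMem₀ hmeas hi).symm (hint i) ih

/-- Chernoff's bound for a sum of a function of independent copies, at parameter one. -/
theorem measureReal_sum_ge_le_of_integral_exp_le [IsProbabilityMeasure P]
    (hlaw : ∀ k, HasLaw (X k) μ P) (hind : iIndepFun X P) {f : 𝓧 → ℝ} (hf : Measurable f)
    (hint : Integrable (fun x => Real.exp (f x)) μ) {M : ℝ}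
    (hM : ∫ x, Real.exp (f x) ∂μ ≤ Real.exp M) (a : ℝ) :
    P.real {ω | a ≤ ∑ k, f (X k ω)} ≤ Real.exp (m * M - a) := by
  have hind' : iIndepFun (fun k ω => f (X k ω)) P := hind.comp (fun _ => f) fun _ => hf
  have hmeas : ∀ k, AEMeasurable (fun ω => f (X k ω)) P := fun k =>
    hf.comp_aemeasurable (hlaw k).aemeasurable
  have hexpm : AEStronglyMeasurable (fun x => Real.exp (f x)) μ := hint.aestronglyMeasurable
  have hint' : ∀ k, Integrable (fun ω => Real.exp (1 * f (X k ω))) P := by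
    intro k
    simp only [one_mul]
    have h := hint
    rw [← (hlaw k).map_eq] at h
    exact (integrable_map_measure h.aestronglyMeasurable (hlaw k).aemeasurable).1 h
  have hmgf : ∀ k, mgf (fun ω => f (X k ω)) P 1 = ∫ x, Real.exp (f x) ∂μ := by
    intro k
    simp only [mgf, one_mul]
    exact (hlaw k).integral_comp hexpm
  have hsum : Integrable (fun ω => Real.exp (1 * (∑ k, fun ω => f (X k ω)) ω)) P :=
    integrable_exp_mul_sum_of_aemeasurable hind' hmeas hint' _
  have h := measure_ge_le_exp_mul_mgf (μ := P) a zero_le_one hsum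
  rw [hind'.mgf_sum₀ hmeas] at h
  simp only [hmgf, Finset.prod_const, Finset.card_univ, Fintype.card_fin, Finset.sum_apply] at h
  refine h.trans ?_
  have h0 : 0 ≤ ∫ x, Real.exp (f x) ∂μ := integral_nonneg fun x => (Real.exp_pos _).le
  calc Real.exp (-1 * a) * (∫ x, Real.exp (f x) ∂μ) ^ m
      ≤ Real.exp (-1 * a) * (Real.exp M) ^ m := by gcongr
    _ = Real.exp (m * M - a) := by
        rw [← Real.exp_nat_mul, ← Real.exp_add]; ring_nf

theorem exp_le_one_add_add_sq {u : ℝ} (hu : |u| ≤ 1) : Real.exp u ≤ 1 + u + u ^ 2 := by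
  have h := Real.abs_exp_sub_one_sub_id_le hu
  linarith [(abs_le.1 h).2]

variable [IsProbabilityMeasure μ]

/-- The exponential moment of a centred function with values in `[-1, 1]` and second moment at
most `v`. -/
theorem integral_exp_centred_le {f : 𝓧 → ℝ} (hf : Measurable f) (hf1 : ∀ x, |f x| ≤ 1) {v : ℝ}
    (hv : ∫ x, f x ^ 2 ∂μ ≤ v) {l : ℝ} (hl : |l| ≤ 1) :
    ∫ x, Real.exp (l * (f x - ∫ y, f y ∂μ)) ∂μ ≤ Real.exp (l ^ 2 * v) := by
  have hif : Integrable f μ := Integrable.of_bound hf.aestronglyMeasurable 1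
    (ae_of_all _ fun x => by simpa using hf1 x)
  have hif2 : Integrable (fun x => f x ^ 2) μ :=
    Integrable.of_bound (hf.pow_const 2).aestronglyMeasurable 1
      (ae_of_all _ fun x => by
        rw [Real.norm_eq_abs, abs_pow]; exact pow_le_one₀ (abs_nonneg _) (hf1 x))
  set e := ∫ y, f y ∂μ with he
  have hpt : ∀ x, Real.exp (l * (f x - e)) ≤
      Real.exp (-(l * e)) * (1 + l * f x + l ^ 2 * f x ^ 2) := by
    intro x
    -- The quadratic bound is applied to `l * f x` before centring, so `|l| ≤ 1` suffices; the
    -- factor `exp (-(l * e))` is cancelled at the end through `1 + u ≤ exp u`.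
    have h1 : |l * f x| ≤ 1 := by
      rw [abs_mul]; exact mul_le_one₀ hl (abs_nonneg _) (hf1 x)
    have h2 := exp_le_one_add_add_sq h1
    rw [show l * (f x - e) = -(l * e) + l * f x by ring, Real.exp_add]
    gcongr
    linarith
  have hib : Integrable (fun x => 1 + l * f x + l ^ 2 * f x ^ 2) μ :=
    ((integrable_const 1).add (hif.const_mul l)).add (hif2.const_mul (l ^ 2))
  calc ∫ x, Real.exp (l * (f x - e)) ∂μ
      ≤ ∫ x, Real.exp (-(l * e)) * (1 + l * f x + l ^ 2 * f x ^ 2) ∂μ :=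
        integral_mono_of_nonneg (ae_of_all _ fun x => (Real.exp_pos _).le)
          (hib.const_mul _) (ae_of_all _ hpt)
    _ = Real.exp (-(l * e)) * (1 + l * e + l ^ 2 * ∫ x, f x ^ 2 ∂μ) := by
        rw [integral_const_mul, integral_add (f := fun x => 1 + l * f x)
          ((integrable_const 1).add (hif.const_mul l)) (hif2.const_mul (l ^ 2)),
          integral_add (integrable_const 1) (hif.const_mul l),
          integral_const_mul, integral_const_mul]
        simp [he]
    _ ≤ Real.exp (-(l * e)) * Real.exp (l * e + l ^ 2 * v) := by
        gcongr
        have := Real.add_one_le_exp (l * e + l ^ 2 * v)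
        have h3 : l ^ 2 * ∫ x, f x ^ 2 ∂μ ≤ l ^ 2 * v := by gcongr
        linarith
    _ = Real.exp (l ^ 2 * v) := by rw [← Real.exp_add]; ring_nf

theorem measureReal_sum_centred_ge_le [IsProbabilityMeasure P]
    (hlaw : ∀ k, HasLaw (X k) μ P) (hind : iIndepFun X P) {f : 𝓧 → ℝ} (hf : Measurable f)
    (hf1 : ∀ x, |f x| ≤ 1) {v t : ℝ} (hv : ∫ x, f x ^ 2 ∂μ ≤ v) (hv0 : 0 < v) (ht : 0 ≤ t)
    (htv : t ≤ 2 * v) :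
    P.real {ω | m * t ≤ ∑ k, f (X k ω) - m * ∫ x, f x ∂μ} ≤
      Real.exp (-(m * (t ^ 2 / (4 * v)))) := by
  -- The minimizer of `l ^ 2 * v - l * t`; `htv` says exactly that it is at most `1`.
  set l := t / (2 * v) with hl
  have hl0 : 0 ≤ l := by positivity
  have hl1 : |l| ≤ 1 := by
    rw [abs_of_nonneg hl0, hl, div_le_one (by positivity)]; exact htv
  have hmeas : Measurable fun x => l * (f x - ∫ y, f y ∂μ) := (hf.sub_const _).const_mul l
  have hbd : ∀ x, |l * (f x - ∫ y, f y ∂μ)| ≤ 1 + |∫ y, f y ∂μ| := by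
    intro x
    rw [abs_mul]
    calc |l| * |f x - ∫ y, f y ∂μ| ≤ 1 * (|f x| + |∫ y, f y ∂μ|) := by
          gcongr; exact abs_sub _ _
      _ ≤ _ := by rw [one_mul]; gcongr; exact hf1 x
  have hint : Integrable (fun x => Real.exp (l * (f x - ∫ y, f y ∂μ))) μ :=
    Integrable.of_bound hmeas.exp.aestronglyMeasurable (Real.exp (1 + |∫ y, f y ∂μ|))
      (ae_of_all _ fun x => by
        rw [Real.norm_eq_abs, Real.abs_exp]
        exact Real.exp_le_exp.2 ((le_abs_self _).trans (hbd x)))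
  have h := measureReal_sum_ge_le_of_integral_exp_le hlaw hind hmeas hint
    (integral_exp_centred_le hf hf1 hv hl1) (l * (m * t))
  refine (measureReal_mono ?_).trans (h.trans (Real.exp_le_exp.2 (le_of_eq ?_)))
  · intro ω hω
    simp only [Set.mem_ofPred_eq] at hω ⊢
    rw [← Finset.mul_sum, Finset.sum_sub_distrib]
    simp only [Finset.sum_const, Finset.card_univ, Fintype.card_fin, nsmul_eq_mul]
    gcongr
  · rw [hl]; field_simp; ring

/-- **Bernstein's inequality** in the sub-Gaussian range for functions with values in `[-1, 1]`. -/
theorem measureReal_abs_sum_centred_ge_le [IsProbabilityMeasure P]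
    (hlaw : ∀ k, HasLaw (X k) μ P) (hind : iIndepFun X P) {f : 𝓧 → ℝ} (hf : Measurable f)
    (hf1 : ∀ x, |f x| ≤ 1) {v t : ℝ} (hv : ∫ x, f x ^ 2 ∂μ ≤ v) (hv0 : 0 < v) (ht : 0 ≤ t)
    (htv : t ≤ 2 * v) :
    P.real {ω | m * t ≤ |∑ k, f (X k ω) - m * ∫ x, f x ∂μ|} ≤
      2 * Real.exp (-(m * (t ^ 2 / (4 * v)))) := by
  have h1 := measureReal_sum_centred_ge_le hlaw hind hf hf1 hv hv0 ht htv
  have h2 := measureReal_sum_centred_ge_le hlaw hind (f := fun x => -f x) hf.neg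
    (fun x => by simpa using hf1 x) (by simpa using hv) hv0 ht htv
  refine (measureReal_mono (s₂ := {ω | m * t ≤ ∑ k, f (X k ω) - m * ∫ x, f x ∂μ} ∪
    {ω | m * t ≤ ∑ k, -f (X k ω) - m * ∫ x, -f x ∂μ}) ?_).trans
      ((measureReal_union_le _ _).trans (by linarith))
  intro ω hω
  simp only [Set.mem_ofPred_eq, Set.mem_union] at hω ⊢
  rcases le_abs.1 hω with h | h
  · exact Or.inl h
  · right
    rw [Finset.sum_neg_distrib, integral_neg]
    linarith

end Tails

/-! ### Marginals of the standard Gaussian and one-dimensional estimates -/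

section Gaussian

variable {E : Type*} [NormedAddCommGroup E] [InnerProductSpace ℝ E] [FiniteDimensional ℝ E]
  [MeasurableSpace E] [BorelSpace E]

theorem hasLaw_inner_stdGaussian {x : E} (hx : ‖x‖ = 1) :
    HasLaw (fun g : E => inner ℝ x g) (gaussianReal 0 1) (stdGaussian E) where
  aemeasurable := by fun_prop
  map_eq := by
    have h := IsGaussian.map_eq_gaussianReal (μ := stdGaussian E) (innerSL ℝ x)
    rw [integral_strongDual_stdGaussian, variance_dual_stdGaussian] at h
    simpa [hx] using h

/-- Characteristic functions agree: pulling back a functional `L` gives the vector `L (1, 0) • x + L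
(0, 1) • u`, whose squared norm splits by orthonormality. -/
theorem hasLaw_inner_prod_stdGaussian {x u : E} (hx : ‖x‖ = 1) (hu : ‖u‖ = 1)
    (hxu : inner ℝ x u = 0) :
    HasLaw (fun g : E => (inner ℝ x g, inner ℝ u g))
      ((gaussianReal 0 1).prod (gaussianReal 0 1)) (stdGaussian E) where
  aemeasurable := by fun_prop
  map_eq := by
    apply Measure.ext_of_charFunDual
    ext L
    have hL : (fun g : E => (inner ℝ x g, inner ℝ u g)) = ⇑((innerSL ℝ x).prod (innerSL ℝ u)) := by
      ext g <;> simp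
    have h1 : L.comp ((innerSL ℝ x).prod (innerSL ℝ u)) =
        innerSL ℝ (L (1, 0) • x + L (0, 1) • u) := by
      ext g
      have : ((inner ℝ x g, inner ℝ u g) : ℝ × ℝ) =
        (inner ℝ x g : ℝ) • ((1, 0) : ℝ × ℝ) + (inner ℝ u g : ℝ) • ((0, 1) : ℝ × ℝ) := by
          simp
      simp only [ContinuousLinearMap.comp_apply, ContinuousLinearMap.prod_apply,
        innerSL_apply_apply]
      rw [this, map_add, map_smul, map_smul, inner_add_left, inner_smul_left, inner_smul_left]
      simp [mul_comm]
    have h2 : ‖L (1, 0) • x + L (0, 1) • u‖ ^ 2 = L (1, 0) ^ 2 + L (0, 1) ^ 2 := by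
      rw [norm_add_sq_real, norm_smul, norm_smul, inner_smul_left, inner_smul_right, hxu, hx, hu]
      simp
    have h3 : ∀ M : StrongDual ℝ ℝ, charFunDual (gaussianReal 0 1) M =
        Complex.exp (-(M 1 : ℂ) ^ 2 / 2) := by
      intro M
      rw [IsGaussian.charFunDual_eq]
      simp [integral_complex_ofReal, integral_continuousLinearMap_gaussianReal,
        variance_continuousLinearMap_gaussianReal, neg_div, max_eq_left (sq_nonneg (M 1))]
    rw [hL, charFunDual_map, charFunDual_stdGaussian, h1, innerSL_apply_norm, charFunDual_prod, h3,
      h3, ← Complex.exp_add, ← Complex.ofReal_pow, h2]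
    congr 1
    simp
    ring

end Gaussian

theorem integral_mul_exp_neg_sq_div_two :
    ∫ r in Set.Ioi (0 : ℝ), r * Real.exp (-(r ^ 2 / 2)) = 1 := by
  have h := integral_rpow_mul_exp_neg_mul_rpow (p := 2) (q := 1) (b := 1 / 2) (by norm_num)
    (by norm_num) (by norm_num)
  rw [show ((1 : ℝ) + 1) / 2 = 1 by norm_num, Real.Gamma_one] at h
  rw [show -((1 : ℝ) + 1) / 2 = -1 by norm_num, Real.rpow_neg_one] at h
  norm_num at h
  rw [← h]
  refine setIntegral_congr_fun measurableSet_Ioi fun r _ => ?_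
  congr 2
  ring

theorem gaussianPDFReal_zero_one (x : ℝ) :
    gaussianPDFReal 0 1 x = (√(2 * Real.pi))⁻¹ * Real.exp (-(x ^ 2 / 2)) := by
  simp [gaussianPDFReal, neg_div]

/-- The integral equals `√2`, and `2 ≤ exp 1`. -/
theorem exp_sq_div_four_gaussianReal :
    Integrable (fun x : ℝ => Real.exp (x ^ 2 / 4)) (gaussianReal 0 1) ∧
      ∫ x, Real.exp (x ^ 2 / 4) ∂gaussianReal 0 1 ≤ Real.exp (1 / 2) := by
  have hpt : ∀ x : ℝ, gaussianPDFReal 0 1 x • Real.exp (x ^ 2 / 4) =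
      (√(2 * Real.pi))⁻¹ * Real.exp (-(1 / 4) * x ^ 2) := by
    intro x
    rw [gaussianPDFReal_zero_one, smul_eq_mul, mul_assoc, ← Real.exp_add]
    ring_nf
  constructor
  · rw [gaussianReal_of_var_ne_zero _ one_ne_zero,
      integrable_withDensity_iff_integrable_smul' (measurable_gaussianPDF _ _)
        (ae_of_all _ fun _ => gaussianPDF_lt_top)]
    simp_rw [toReal_gaussianPDF, hpt]
    exact (integrable_exp_neg_mul_sq (by norm_num)).const_mul _
  · rw [integral_gaussianReal_eq_integral_smul one_ne_zero]
    simp_rw [hpt]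
    rw [integral_const_mul, integral_gaussian]
    have h2 : (√(2 * Real.pi))⁻¹ * √(Real.pi / (1 / 4)) = √2 := by
      rw [← Real.sqrt_inv, ← Real.sqrt_mul (by positivity)]
      congr 1
      field_simp
      norm_num
    rw [h2]
    refine Real.sqrt_le_iff.2 ⟨(Real.exp_pos _).le, ?_⟩
    rw [← Real.exp_nat_mul]
    norm_num
    linarith [Real.add_one_le_exp (1 : ℝ)]

theorem gaussianReal_abs_le {τ : ℝ} (hτ : 0 ≤ τ) :
    (gaussianReal 0 1).real {x | |x| ≤ τ} ≤ τ := by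
  have hset : {x : ℝ | |x| ≤ τ} = Set.Icc (-τ) τ := by ext x; simp [abs_le]
  have hb : ∀ x, gaussianPDFReal 0 1 x ≤ 1 / 2 := by
    intro x
    rw [gaussianPDFReal_zero_one]
    have h1 : 2 ≤ √(2 * Real.pi) := by
      apply Real.le_sqrt_of_sq_le
      nlinarith [Real.pi_gt_three]
    calc (√(2 * Real.pi))⁻¹ * Real.exp (-(x ^ 2 / 2)) ≤ 2⁻¹ * 1 := by
          gcongr
          exact Real.exp_le_one_iff.2 (by nlinarith [sq_nonneg x])
      _ = 1 / 2 := by norm_num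
  rw [measureReal_def, gaussianReal_apply_eq_integral 0 one_ne_zero, hset,
    ENNReal.toReal_ofReal (integral_nonneg fun x => gaussianPDFReal_nonneg _ _ _)]
  calc ∫ x in Set.Icc (-τ) τ, gaussianPDFReal 0 1 x ≤ ∫ x in Set.Icc (-τ) τ, (1 / 2 : ℝ) := by
        refine integral_mono (integrable_gaussianPDFReal _ _).restrict ?_ hb
        simp
    _ = τ := by
        simp [hτ]
        ring

/-! ### Probability that a random hyperplane separates two vectors -/

theorem cos_wedge_iff {θ φ : ℝ} (h0 : 0 ≤ θ) (hπ : θ < Real.pi)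
    (hφ : φ ∈ Set.Ioo (-Real.pi) Real.pi) :
    (0 < Real.cos φ ∧ Real.cos (φ - θ) ≤ 0) ↔ φ ∈ Set.Ioc (-(Real.pi / 2)) (θ - Real.pi / 2) := by
  have hp := Real.pi_pos
  constructor
  · rintro ⟨h1, h2⟩
    have h3 : φ ∈ Set.Ioo (-(Real.pi / 2)) (Real.pi / 2) := by
      by_contra hcon
      rw [Set.mem_Ioo, not_and_or, not_lt, not_lt] at hcon
      rcases hcon with h | h
      · have := Real.cos_nonpos_of_pi_div_two_le_of_le (x := -φ) (by linarith) (by linarith [hφ.1])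
        rw [Real.cos_neg] at this
        linarith
      · have := Real.cos_nonpos_of_pi_div_two_le_of_le (x := φ) (by linarith) (by linarith [hφ.2])
        linarith
    refine ⟨h3.1, ?_⟩
    by_contra hcon
    push Not at hcon
    have := Real.cos_pos_of_mem_Ioo (x := φ - θ) ⟨by linarith, by linarith [h3.2]⟩
    linarith
  · rintro ⟨h1, h2⟩
    refine ⟨Real.cos_pos_of_mem_Ioo ⟨h1, by linarith⟩, ?_⟩
    have := Real.cos_nonpos_of_pi_div_two_le_of_le (x := -(φ - θ)) (by linarith) (by linarith)
    rwa [Real.cos_neg] at this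

/-- In polar coordinates the wedge is a condition on the angle alone, an arc of length `θ`; since `θ
< π`, the arc does not wrap around the cut at `±π`. The radial integral is `1`. -/
theorem gaussianReal_prod_wedge {θ : ℝ} (h0 : 0 ≤ θ) (hπ : θ < Real.pi) :
    ((gaussianReal 0 1).prod (gaussianReal 0 1)).real
      {p : ℝ × ℝ | 0 < p.1 ∧ Real.cos θ * p.1 + Real.sin θ * p.2 ≤ 0} = θ / (2 * Real.pi) := by
  set W := {p : ℝ × ℝ | 0 < p.1 ∧ Real.cos θ * p.1 + Real.sin θ * p.2 ≤ 0} with hW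
  have hWm : MeasurableSet W := by
    have h : Measurable fun p : ℝ × ℝ => Real.cos θ * p.1 + Real.sin θ * p.2 := by fun_prop
    exact (measurableSet_lt measurable_const measurable_fst).inter
      (measurableSet_le h measurable_const)
  have hp := Real.pi_pos
  have h1 : ((gaussianReal 0 1).prod (gaussianReal 0 1)).real W =
      ∫ p : ℝ × ℝ, (2 * Real.pi)⁻¹ * Real.exp (-((p.1 ^ 2 + p.2 ^ 2) / 2)) *
        W.indicator (fun _ => (1 : ℝ)) p := by
    rw [← integral_indicator_one hWm, gaussianReal_of_var_ne_zero _ one_ne_zero,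
      prod_withDensity (measurable_gaussianPDF _ _) (measurable_gaussianPDF _ _),
      integral_withDensity_eq_integral_toReal_smul
        (f := fun z : ℝ × ℝ => gaussianPDF 0 1 z.1 * gaussianPDF 0 1 z.2)
        (((measurable_gaussianPDF _ _).comp measurable_fst).mul
          ((measurable_gaussianPDF _ _).comp measurable_snd))
        (ae_of_all _ fun _ => ENNReal.mul_lt_top gaussianPDF_lt_top gaussianPDF_lt_top)]
    congr 1 with p
    simp only [ENNReal.toReal_mul, toReal_gaussianPDF, gaussianPDFReal_zero_one, smul_eq_mul,
      Pi.one_def]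
    have hs : (√(2 * Real.pi))⁻¹ * (√(2 * Real.pi))⁻¹ = (2 * Real.pi)⁻¹ := by
      rw [← mul_inv, Real.mul_self_sqrt (by positivity)]
    rw [← hs, show -((p.1 ^ 2 + p.2 ^ 2) / 2) = -(p.1 ^ 2 / 2) + -(p.2 ^ 2 / 2) by ring,
      Real.exp_add]
    ring
  rw [h1, ← integral_comp_polarCoord_symm, polarCoord_target]
  have h2 : ∀ p ∈ Set.Ioi (0 : ℝ) ×ˢ Set.Ioo (-Real.pi) Real.pi,
      p.1 • ((2 * Real.pi)⁻¹ * Real.exp (-(((polarCoord.symm p).1 ^ 2 +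
        (polarCoord.symm p).2 ^ 2) / 2)) * W.indicator (fun _ => (1 : ℝ)) (polarCoord.symm p)) =
      ((2 * Real.pi)⁻¹ * (p.1 * Real.exp (-(p.1 ^ 2 / 2)))) *
        (Set.Ioc (-(Real.pi / 2)) (θ - Real.pi / 2)).indicator (fun _ => (1 : ℝ)) p.2 := by
    rintro ⟨r, φ⟩ ⟨hr, hφ⟩
    simp only [Set.mem_Ioi] at hr
    have hmem : (polarCoord.symm (r, φ) ∈ W) ↔
        φ ∈ Set.Ioc (-(Real.pi / 2)) (θ - Real.pi / 2) := by
      rw [← cos_wedge_iff h0 hπ hφ, hW, polarCoord_symm_apply, Set.mem_ofPred_eq,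
        show Real.cos θ * (r * Real.cos φ) + Real.sin θ * (r * Real.sin φ) =
          r * Real.cos (φ - θ) by rw [Real.cos_sub]; ring,
        mul_pos_iff_of_pos_left hr, ← not_lt, mul_pos_iff_of_pos_left hr, not_lt]
    have hsq : (polarCoord.symm (r, φ)).1 ^ 2 + (polarCoord.symm (r, φ)).2 ^ 2 = r ^ 2 := by
      rw [polarCoord_symm_apply]
      nlinarith [Real.sin_sq_add_cos_sq φ]
    rw [hsq]
    by_cases h : φ ∈ Set.Ioc (-(Real.pi / 2)) (θ - Real.pi / 2)
    · rw [Set.indicator_of_mem h, Set.indicator_of_mem (hmem.2 h), smul_eq_mul]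
      ring
    · rw [Set.indicator_of_notMem h, Set.indicator_of_notMem (mt hmem.1 h)]
      simp
  rw [setIntegral_congr_fun (measurableSet_Ioi.prod measurableSet_Ioo) h2, Measure.volume_eq_prod,
    setIntegral_prod_mul (fun r : ℝ => (2 * Real.pi)⁻¹ * (r * Real.exp (-(r ^ 2 / 2))))
      ((Set.Ioc (-(Real.pi / 2)) (θ - Real.pi / 2)).indicator fun _ => (1 : ℝ)),
    integral_const_mul, integral_mul_exp_neg_sq_div_two, setIntegral_indicator measurableSet_Ioc]
  have h3 : Set.Ioo (-Real.pi) Real.pi ∩ Set.Ioc (-(Real.pi / 2)) (θ - Real.pi / 2) =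
      Set.Ioc (-(Real.pi / 2)) (θ - Real.pi / 2) :=
    Set.inter_eq_right.2 fun φ hφ => ⟨by linarith [hφ.1], by linarith [hφ.2]⟩
  rw [h3]
  simp [h0]
  field_simp

section Wedge

variable {E : Type*} [NormedAddCommGroup E] [InnerProductSpace ℝ E]

/-- The indicator that the hyperplane orthogonal to `g` separates `x` from `y`. -/
noncomputable def signDiff (x y g : E) : ℝ :=
  if sgn (inner ℝ x g) ≠ sgn (inner ℝ y g) then 1 else 0

theorem sgn_ne_sgn_iff (a b : ℝ) : sgn a ≠ sgn b ↔ (0 < a ∧ b ≤ 0) ∨ (0 < b ∧ a ≤ 0) := by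
  unfold sgn
  by_cases ha : 0 < a <;> by_cases hb : 0 < b <;> simp [ha, hb] <;> grind

theorem signDiff_nonneg (x y g : E) : 0 ≤ signDiff x y g := by
  unfold signDiff; split_ifs <;> norm_num

theorem signDiff_le_one (x y g : E) : signDiff x y g ≤ 1 := by
  unfold signDiff; split_ifs <;> norm_num

theorem signDiff_comm (x y g : E) : signDiff x y g = signDiff y x g := by
  simp only [signDiff, ne_comm]

theorem signDiff_triangle (x y z g : E) : signDiff x z g ≤ signDiff x y g + signDiff y z g := by
  unfold signDiff; split_ifs <;> grind

theorem abs_signDiff_sub_le (x y x' y' g : E) :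
    |signDiff x y g - signDiff x' y' g| ≤ signDiff x x' g + signDiff y y' g := by
  rw [abs_le]
  constructor
  · have h1 := signDiff_triangle x' x y' g
    have h2 := signDiff_triangle x y y' g
    rw [signDiff_comm x' x] at h1
    linarith
  · have h1 := signDiff_triangle x x' y g
    have h2 := signDiff_triangle x' y' y g
    rw [signDiff_comm y' y] at h2
    linarith

theorem abs_signDiff_sub_le_one (x y x' y' g : E) :
    |signDiff x y g - signDiff x' y' g| ≤ 1 := by
  rw [abs_le]
  constructor <;> linarith [signDiff_nonneg x y g, signDiff_nonneg x' y' g, signDiff_le_one x y g,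
    signDiff_le_one x' y' g]

/-- The difference has absolute value at most `1`, so its square is at most its absolute value. This
makes the variance of a chaining increment linear in the distance moved. -/
theorem sq_signDiff_sub_le (x y x' y' g : E) :
    (signDiff x y g - signDiff x' y' g) ^ 2 ≤ signDiff x x' g + signDiff y y' g := by
  rw [← sq_abs]
  have h1 := abs_signDiff_sub_le_one x y x' y' g
  have h2 := abs_signDiff_sub_le x y x' y' g
  have h3 := abs_nonneg (signDiff x y g - signDiff x' y' g)
  nlinarith

theorem sq_signDiff (x y g : E) : signDiff x y g ^ 2 = signDiff x y g := by
  unfold signDiff; split_ifs <;> norm_num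

theorem signDiff_eq_indicator (x y g : E) :
    signDiff x y g = {g : E | 0 < (inner ℝ x g : ℝ) ∧ (inner ℝ y g : ℝ) ≤ 0}.indicator 1 g +
      {g : E | 0 < (inner ℝ y g : ℝ) ∧ (inner ℝ x g : ℝ) ≤ 0}.indicator 1 g := by
  unfold signDiff
  simp only [sgn_ne_sgn_iff, Set.indicator, Set.mem_ofPred_eq, Pi.one_apply]
  split_ifs <;> grind

variable [MeasurableSpace E] [BorelSpace E]

theorem measurableSet_wedge [SecondCountableTopology E] (x y : E) :
    MeasurableSet {g : E | 0 < (inner ℝ x g : ℝ) ∧ (inner ℝ y g : ℝ) ≤ 0} := by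
  have h : ∀ z : E, Measurable fun g : E => (inner ℝ z g : ℝ) := fun z => by fun_prop
  exact (measurableSet_lt measurable_const (h x)).inter (measurableSet_le (h y) measurable_const)

variable [FiniteDimensional ℝ E]

theorem measurable_signDiff (x y : E) : Measurable (signDiff x y) := by
  rw [funext (signDiff_eq_indicator x y)]
  exact (measurable_one.indicator (measurableSet_wedge x y)).add
    (measurable_one.indicator (measurableSet_wedge y x))

theorem integrable_signDiff (x y : E) : Integrable (signDiff x y) (stdGaussian E) :=
  Integrable.of_bound (measurable_signDiff x y).aestronglyMeasurable 1
    (ae_of_all _ fun g => by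
      rw [Real.norm_eq_abs, abs_of_nonneg (signDiff_nonneg x y g)]
      exact signDiff_le_one x y g)

theorem stdGaussian_wedge {x y : E} (hx : ‖x‖ = 1) (hy : ‖y‖ = 1) (hxy : inner ℝ x y ≠ (-1 : ℝ)) :
    (stdGaussian E).real {g : E | 0 < (inner ℝ x g : ℝ) ∧ (inner ℝ y g : ℝ) ≤ 0} =
      Real.arccos (inner ℝ x y) / (2 * Real.pi) := by
  have habs : |(inner ℝ x y : ℝ)| ≤ 1 := by
    simpa [hx, hy] using abs_real_inner_le_norm x y
  obtain ⟨hl, hr⟩ := abs_le.1 habs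
  have hl' : -1 < (inner ℝ x y : ℝ) := lt_of_le_of_ne hl (Ne.symm hxy)
  rcases eq_or_ne (inner ℝ x y : ℝ) 1 with h1 | h1
  · have hxy' : x = y := (inner_eq_one_iff_of_norm_eq_one hx hy).1 h1
    subst hxy'
    have : {g : E | 0 < (inner ℝ x g : ℝ) ∧ (inner ℝ x g : ℝ) ≤ 0} = ∅ := by
      ext g; simp
    rw [this, h1]
    simp
  have hr' : (inner ℝ x y : ℝ) < 1 := lt_of_le_of_ne hr h1
  set θ := Real.arccos (inner ℝ x y) with hθ
  have hθ0 : 0 < θ := Real.arccos_pos.2 hr'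
  have hθπ : θ < Real.pi := by
    refine lt_of_le_of_ne (Real.arccos_le_pi _) fun h => ?_
    rw [hθ, Real.arccos_eq_pi] at h
    linarith
  have hcos : Real.cos θ = inner ℝ x y := Real.cos_arccos hl hr
  have hsin : 0 < Real.sin θ := Real.sin_pos_of_pos_of_lt_pi hθ0 hθπ
  have hsc := Real.sin_sq_add_cos_sq θ
  -- Gram–Schmidt: `u` completes `x` to an orthonormal pair with `y = cos θ • x + sin θ • u`, so the
  -- event depends on two independent Gaussian coordinates.
  set u : E := (Real.sin θ)⁻¹ • (y - Real.cos θ • x) with hu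
  have hyu : y = Real.cos θ • x + Real.sin θ • u := by
    rw [hu, smul_inv_smul₀ hsin.ne']; abel
  have hxx : (inner ℝ x x : ℝ) = 1 := by rw [real_inner_self_eq_norm_sq, hx]; norm_num
  have hyy : (inner ℝ y y : ℝ) = 1 := by rw [real_inner_self_eq_norm_sq, hy]; norm_num
  have hxu : inner ℝ x u = (0 : ℝ) := by
    rw [hu, inner_smul_right, inner_sub_right, inner_smul_right, hxx, hcos]
    simp
  have hun : ‖u‖ = 1 := by
    have h2 : (inner ℝ y y : ℝ) = Real.cos θ ^ 2 + Real.sin θ ^ 2 * ‖u‖ ^ 2 := by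
      conv_lhs => rw [hyu]
      have hux : inner ℝ u x = (0 : ℝ) := by rw [real_inner_comm]; exact hxu
      simp only [inner_add_left, inner_add_right, inner_smul_left, inner_smul_right, hxu, hux, hxx,
        real_inner_self_eq_norm_sq u]
      simp
      ring
    rw [hyy] at h2
    have h3 : Real.sin θ ^ 2 * ‖u‖ ^ 2 = Real.sin θ ^ 2 * 1 := by linarith
    have h4 := mul_left_cancel₀ (pow_ne_zero 2 hsin.ne') h3
    nlinarith [norm_nonneg u]
  rw [← gaussianReal_prod_wedge hθ0.le hθπ]
  have hm : MeasurableSet {p : ℝ × ℝ | 0 < p.1 ∧ Real.cos θ * p.1 + Real.sin θ * p.2 ≤ 0} := by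
    have h : Measurable fun p : ℝ × ℝ => Real.cos θ * p.1 + Real.sin θ * p.2 := by fun_prop
    exact (measurableSet_lt measurable_const measurable_fst).inter
      (measurableSet_le h measurable_const)
  rw [← (hasLaw_inner_prod_stdGaussian hx hun hxu).measureReal_eq hm]
  congr 1 with g
  have : (inner ℝ y g : ℝ) = Real.cos θ * inner ℝ x g + Real.sin θ * inner ℝ u g := by
    conv_lhs => rw [hyu]
    simp [inner_add_left, inner_smul_left]
  simp only [Set.mem_ofPred_eq, this]

/-- The hyperplane orthogonal to a Gaussian vector separates two unit vectors with probability
proportional to their angle. -/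
theorem integral_signDiff {x y : E} (hx : ‖x‖ = 1) (hy : ‖y‖ = 1) :
    ∫ g, signDiff x y g ∂stdGaussian E = Real.arccos (inner ℝ x y) / Real.pi := by
  have hp := Real.pi_pos
  rcases eq_or_ne (inner ℝ x y : ℝ) (-1) with h | h
  -- Antipodal points span only a line; they are separated unless `⟨y, g⟩ = 0`, a null event.
  · have hxy : x = -y := (inner_eq_neg_one_iff_of_norm_eq_one hx hy).1 h
    have hae : ∀ᵐ g ∂stdGaussian E, signDiff x y g = 1 := by
      have h0 : ∀ᵐ g ∂stdGaussian E, (inner ℝ y g : ℝ) ≠ 0 := by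
        have hy' := hasLaw_inner_stdGaussian hy
        have := nullSingletonClass_gaussianReal (μ := 0) (v := 1) one_ne_zero
        rw [hy'.ae_iff (p := fun t => t ≠ 0)
          (measurableSet_setOfPred.1 (measurableSet_singleton (0 : ℝ)).compl)]
        simp [ae_iff]
      filter_upwards [h0] with g hg
      rw [signDiff, if_pos]
      rw [sgn_ne_sgn_iff, hxy, inner_neg_left]
      rcases lt_or_gt_of_ne hg with h | h
      · left; constructor <;> linarith
      · right; constructor <;> linarith
    rw [integral_congr_ae hae, h, Real.arccos_neg_one]
    simp [hp.ne']
  · have hi : ∀ a b : E, Integrable ({g : E | 0 < (inner ℝ a g : ℝ) ∧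
        (inner ℝ b g : ℝ) ≤ 0}.indicator (1 : E → ℝ)) (stdGaussian E) := fun a b =>
      (integrable_const (1 : ℝ)).indicator (measurableSet_wedge a b)
    rw [integral_congr_ae (ae_of_all _ (signDiff_eq_indicator x y)),
      integral_add (hi x y) (hi y x), integral_indicator_one (measurableSet_wedge x y),
      integral_indicator_one (measurableSet_wedge y x), stdGaussian_wedge hx hy h,
      stdGaussian_wedge hy hx (by rwa [real_inner_comm]), real_inner_comm]
    field_simp
    ring

end Wedge

/-! ### Geodesic distance as an expectation -/

section GeoDist

variable {n : ℕ} {x y z w : EuclideanSpace ℝ (Fin n)}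

theorem integral_signDiff_eq_geoDist (hx : ‖x‖ = 1) (hy : ‖y‖ = 1) :
    ∫ g, signDiff x y g ∂stdGaussian (EuclideanSpace ℝ (Fin n)) = geoDist x y :=
  integral_signDiff hx hy

/-- The chord of an angle `θ` is `2 sin (θ/2)`, and Jordan's inequality bounds the sine below. -/
theorem geoDist_le (hx : ‖x‖ = 1) (hy : ‖y‖ = 1) : geoDist x y ≤ ‖x - y‖ / 2 := by
  have hp := Real.pi_pos
  have habs : |(inner ℝ x y : ℝ)| ≤ 1 := by
    simpa [hx, hy] using abs_real_inner_le_norm x y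
  obtain ⟨hl, hr⟩ := abs_le.1 habs
  unfold geoDist
  set θ := Real.arccos (inner ℝ x y) with hθ
  have h0 : 0 ≤ θ := Real.arccos_nonneg _
  have hπ : θ ≤ Real.pi := Real.arccos_le_pi _
  have hcos : Real.cos θ = inner ℝ x y := Real.cos_arccos hl hr
  have hn : ‖x - y‖ ^ 2 = (2 * Real.sin (θ / 2)) ^ 2 := by
    rw [norm_sub_sq_real, hx, hy, ← hcos]
    have h1 : Real.cos θ = 1 - 2 * Real.sin (θ / 2) ^ 2 := by
      rw [show θ = 2 * (θ / 2) by ring, Real.cos_two_mul, Real.cos_sq']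
      ring_nf
    rw [h1]; ring
  have hs : 0 ≤ Real.sin (θ / 2) := Real.sin_nonneg_of_nonneg_of_le_pi (by linarith) (by linarith)
  have hn' : ‖x - y‖ = 2 * Real.sin (θ / 2) :=
    (sq_eq_sq₀ (norm_nonneg _) (by positivity)).1 hn
  have hj := Real.mul_le_sin (x := θ / 2) (by linarith) (by linarith)
  rw [hn']
  have : θ / Real.pi = 2 / Real.pi * (θ / 2) := by field_simp
  linarith

/-- Inherited from the pointwise inequality for `signDiff` by integration. -/
theorem abs_geoDist_sub_le (hx : ‖x‖ = 1) (hy : ‖y‖ = 1) (hz : ‖z‖ = 1) (hw : ‖w‖ = 1) :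
    |geoDist x y - geoDist z w| ≤ geoDist x z + geoDist y w := by
  rw [← integral_signDiff_eq_geoDist hx hy, ← integral_signDiff_eq_geoDist hz hw,
    ← integral_signDiff_eq_geoDist hx hz, ← integral_signDiff_eq_geoDist hy hw,
    ← integral_sub (integrable_signDiff x y) (integrable_signDiff z w),
    ← integral_add (integrable_signDiff x z) (integrable_signDiff y w)]
  refine abs_integral_le_integral_abs.trans (integral_mono
    ((integrable_signDiff x y).sub (integrable_signDiff z w)).abs
    ((integrable_signDiff x z).add (integrable_signDiff y w)) fun g => ?_)
  exact abs_signDiff_sub_le x y z w g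

end GeoDist

/-! ### Nets of the sparse sphere -/

section Nets

/-- A volume bound for separated subsets of the unit ball. -/
theorem card_le_of_separated_of_norm_le_one {F : Type*} [NormedAddCommGroup F] [NormedSpace ℝ F]
    [FiniteDimensional ℝ F] {r : ℝ} (hr : 0 < r) (hr1 : r ≤ 1) (N : Finset F)
    (hN : ∀ c ∈ N, ‖c‖ ≤ 1) (hsep : ∀ c ∈ N, ∀ d ∈ N, c ≠ d → r < ‖c - d‖) :
    (N.card : ℝ) ≤ (3 / r) ^ Module.finrank ℝ F := by
  borelize F
  let μ : Measure F := Measure.addHaar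
  have hr2 : 0 < r / 2 := by positivity
  have hR : 0 < 1 + r / 2 := by positivity
  have hD : Set.Pairwise (N : Set F)
      (Function.onFun Disjoint fun c => Metric.ball (c : F) (r / 2)) := by
    rintro c hc d hd hcd
    apply Metric.ball_disjoint_ball
    rw [dist_eq_norm]
    linarith [hsep c hc d hd hcd]
  have hsub : (⋃ c ∈ N, Metric.ball (c : F) (r / 2)) ⊆ Metric.ball (0 : F) (1 + r / 2) := by
    refine Set.iUnion₂_subset fun x hx => ?_
    apply Metric.ball_subset_ball'
    rw [dist_zero_right]
    linarith [hN x hx]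
  have hI : (N.card : ENNReal) * ENNReal.ofReal ((r / 2) ^ Module.finrank ℝ F) *
      μ (Metric.ball 0 1) ≤
      ENNReal.ofReal ((1 + r / 2) ^ Module.finrank ℝ F) * μ (Metric.ball 0 1) :=
    calc (N.card : ENNReal) * ENNReal.ofReal ((r / 2) ^ Module.finrank ℝ F) * μ (Metric.ball 0 1)
        = μ (⋃ c ∈ N, Metric.ball (c : F) (r / 2)) := by
          rw [measure_biUnion_finset hD fun c _ => measurableSet_ball]
          simp only [μ.addHaar_ball_of_pos _ hr2, Finset.sum_const, nsmul_eq_mul, mul_assoc]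
      _ ≤ μ (Metric.ball (0 : F) (1 + r / 2)) := measure_mono hsub
      _ = _ := by simp only [μ.addHaar_ball_of_pos _ hR]
  have hJ := (ENNReal.mul_le_mul_iff_left (Metric.measure_ball_pos _ _ zero_lt_one).ne'
    measure_ball_lt_top.ne).1 hI
  have hK := ENNReal.toReal_le_of_le_ofReal (pow_nonneg hR.le _) hJ
  rw [ENNReal.toReal_mul, ENNReal.toReal_natCast, ENNReal.toReal_ofReal (by positivity)] at hK
  calc (N.card : ℝ) ≤ (1 + r / 2) ^ Module.finrank ℝ F / (r / 2) ^ Module.finrank ℝ F := by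
        rwa [le_div_iff₀ (by positivity)]
    _ = ((1 + r / 2) / (r / 2)) ^ Module.finrank ℝ F := (div_pow _ _ _).symm
    _ ≤ (3 / r) ^ Module.finrank ℝ F := by
        gcongr ?_ ^ _
        rw [div_le_div_iff₀ hr2 hr]
        nlinarith

/-- A separated subset of `T` of maximal cardinality is a net, and the volume bound makes the
maximum exist. The net stays inside `T`, so net points of the sparse sphere are again unit vectors.
-/
theorem exists_net_of_norm_le_one {F : Type*} [NormedAddCommGroup F] [NormedSpace ℝ F]
    [FiniteDimensional ℝ F] {r : ℝ} (hr : 0 < r) (hr1 : r ≤ 1) (T : Set F)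
    (hT : ∀ c ∈ T, ‖c‖ ≤ 1) :
    ∃ N : Finset F, (N : Set F) ⊆ T ∧ (N.card : ℝ) ≤ (3 / r) ^ Module.finrank ℝ F ∧
      ∀ x ∈ T, ∃ y ∈ N, ‖x - y‖ ≤ r := by
  classical
  let p : ℕ → Prop := fun k => ∃ N : Finset F, (N : Set F) ⊆ T ∧
    (∀ c ∈ N, ∀ d ∈ N, c ≠ d → r < ‖c - d‖) ∧ N.card = k
  have hbound : ∀ k, p k → k ≤ ⌊(3 / r) ^ Module.finrank ℝ F⌋₊ := by
    rintro k ⟨N, hNT, hsep, rfl⟩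
    exact Nat.le_floor (card_le_of_separated_of_norm_le_one hr hr1 N (fun c hc => hT c (hNT hc))
      hsep)
  have h0 : p 0 := ⟨∅, by simp⟩
  obtain ⟨N, hNT, hsep, hcard⟩ :=
    Nat.findGreatest_spec (P := p) (Nat.zero_le ⌊(3 / r) ^ Module.finrank ℝ F⌋₊) h0
  refine ⟨N, hNT, card_le_of_separated_of_norm_le_one hr hr1 N (fun c hc => hT c (hNT hc)) hsep,
    fun x hx => ?_⟩
  by_contra! hcon
  have hxN : x ∉ N := fun h => by
    have := hcon x h
    simp at this
    linarith
  have hp : p (N.card + 1) := by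
    refine ⟨insert x N, ?_, ?_, Finset.card_insert_of_notMem hxN⟩
    · rw [Finset.coe_insert]
      exact Set.insert_subset hx hNT
    · intro c hc d hd hcd
      rcases Finset.mem_insert.1 hc with rfl | hc' <;> rcases Finset.mem_insert.1 hd with rfl | hd'
      · exact absurd rfl hcd
      · exact hcon d hd'
      · rw [norm_sub_rev]; exact hcon c hc'
      · exact hsep c hc' d hd' hcd
  have := Nat.le_findGreatest (hbound _ hp) hp
  omega

/-- The vectors of `ℝⁿ` supported in `S`. -/
def supportedIn {n : ℕ} (S : Finset (Fin n)) : Submodule ℝ (EuclideanSpace ℝ (Fin n)) where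
  carrier := {x | ∀ i ∉ S, x i = 0}
  add_mem' {a b} ha hb i hi := by simp [ha i hi, hb i hi]
  zero_mem' i _ := by simp
  smul_mem' c a ha i hi := by simp [ha i hi]

theorem finrank_supportedIn_le {n : ℕ} (S : Finset (Fin n)) :
    Module.finrank ℝ (supportedIn S) ≤ S.card := by
  let f : supportedIn S →ₗ[ℝ] (S → ℝ) :=
    { toFun := fun x i => x.1 i
      map_add' := fun x y => by ext i; simp
      map_smul' := fun c x => by ext i; simp }
  have hf : Function.Injective f := by
    intro x y hxy
    ext i
    by_cases hi : i ∈ S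
    · exact congrFun hxy ⟨i, hi⟩
    · rw [x.2 i hi, y.2 i hi]
  simpa using LinearMap.finrank_le_finrank_of_injective hf

theorem choose_le_pow {n s : ℕ} (hs : 1 ≤ s) :
    (n.choose s : ℝ) ≤ (Real.exp 1 * n / s) ^ s := by
  have hs0 : (0 : ℝ) < s := by exact_mod_cast hs
  have h1 := Nat.choose_le_pow_div (α := ℝ) s n
  have h2 := Real.pow_div_factorial_le_exp (x := (s : ℝ)) hs0.le s
  have hf : (0 : ℝ) < s.factorial := by exact_mod_cast s.factorial_pos
  calc (n.choose s : ℝ) ≤ (n : ℝ) ^ s / s.factorial := h1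
    _ = ((n : ℝ) / s) ^ s * ((s : ℝ) ^ s / s.factorial) := by
        rw [div_pow]; field_simp
    _ ≤ ((n : ℝ) / s) ^ s * Real.exp s := by gcongr
    _ = (Real.exp 1 * n / s) ^ s := by
        rw [mul_div_assoc, mul_pow, ← Real.exp_nat_mul, mul_one, mul_comm]

/-- Nets of the sparse sphere, approximating each point with an error of the same sparsity. -/
theorem exists_net_sparseSphere {n s : ℕ} (hs : 1 ≤ s) (hsn : s ≤ n) {r : ℝ} (hr : 0 < r)
    (hr1 : r ≤ 1) :
    ∃ N : Finset (EuclideanSpace ℝ (Fin n)), (∀ y ∈ N, y ∈ sparseSphere n s) ∧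
      (N.card : ℝ) ≤ Real.exp (s * Real.log (Real.exp 1 * n / s) + s * Real.log (3 / r)) ∧
      ∀ x ∈ sparseSphere n s, ∃ y ∈ N, ‖x - y‖ ≤ r ∧
        (Finset.univ.filter fun j => (x - y) j ≠ 0).card ≤ s := by
  classical
  have hn0 : (0 : ℝ) < n := by exact_mod_cast (by omega : 0 < n)
  have hs0 : (0 : ℝ) < s := by exact_mod_cast hs
  have h := fun S : Finset (Fin n) => exists_net_of_norm_le_one hr hr1
    {x : supportedIn S | ‖x‖ = 1} (fun c hc => le_of_eq hc)
  choose M hMT hMcard hMnet using h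
  refine ⟨(Finset.powersetCard s Finset.univ).biUnion fun S => (M S).image Subtype.val,
    ?_, ?_, ?_⟩
  · intro y hy
    simp only [Finset.mem_biUnion, Finset.mem_powersetCard_univ, Finset.mem_image] at hy
    obtain ⟨S, hS, z, hz, rfl⟩ := hy
    refine ⟨hMT S hz, ?_⟩
    rw [← hS]
    refine Finset.card_le_card fun j hj => ?_
    by_contra hjS
    exact (Finset.mem_filter.1 hj).2 (z.2 j hjS)
  · have h3 : 1 ≤ 3 / r := by rw [le_div_iff₀ hr]; linarith
    calc ((((Finset.powersetCard s Finset.univ).biUnion fun S =>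
            (M S).image Subtype.val).card : ℕ) : ℝ)
        ≤ ∑ S ∈ Finset.powersetCard s Finset.univ, (((M S).image Subtype.val).card : ℝ) := by
          exact_mod_cast Finset.card_biUnion_le
      _ ≤ ∑ S ∈ Finset.powersetCard s (Finset.univ : Finset (Fin n)), (3 / r) ^ s := by
          refine Finset.sum_le_sum fun S hS => ?_
          have hS' : S.card = s := by simpa using hS
          calc (((M S).image Subtype.val).card : ℝ) ≤ ((M S).card : ℝ) := by
                exact_mod_cast Finset.card_image_le
            _ ≤ (3 / r) ^ Module.finrank ℝ (supportedIn S) := hMcard S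
            _ ≤ (3 / r) ^ s := pow_le_pow_right₀ h3 (hS' ▸ finrank_supportedIn_le S)
      _ = (n.choose s : ℝ) * (3 / r) ^ s := by simp
      _ ≤ (Real.exp 1 * n / s) ^ s * (3 / r) ^ s := by
          gcongr
          exact choose_le_pow hs
      _ = Real.exp (s * Real.log (Real.exp 1 * n / s) + s * Real.log (3 / r)) := by
          rw [Real.exp_add, Real.exp_nat_mul, Real.exp_nat_mul, Real.exp_log (by positivity),
            Real.exp_log (by positivity)]
  · rintro x ⟨hx1, hxs⟩
    -- Padding the support to size exactly `s` puts `x` and its net point in the same coordinate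
    -- subspace; hence `x - y` is `s`-sparse and not merely `2s`-sparse.
    obtain ⟨S, hS, hScard⟩ := Finset.exists_superset_card_eq hxs (by simpa using hsn)
    have hxS : x ∈ supportedIn S := fun i hi => by
      by_contra h
      exact hi (hS (by simpa using h))
    obtain ⟨y, hy, hxy⟩ := hMnet S ⟨x, hxS⟩ hx1
    refine ⟨y, ?_, hxy, ?_⟩
    · simp only [Finset.mem_biUnion, Finset.mem_powersetCard_univ, Finset.mem_image]
      exact ⟨S, hScard, y, hy, rfl⟩
    · rw [← hScard]
      refine Finset.card_le_card fun j hj => ?_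
      by_contra hjS
      exact (Finset.mem_filter.1 hj).2 ((supportedIn S).sub_mem hxS y.2 j hjS)

end Nets

/-! ### Deterministic chaining argument -/

section Chaining

variable {m n s : ℕ}

theorem cubeDist_signLinear (A : Matrix (Fin m) (Fin n) ℝ) (x y : EuclideanSpace ℝ (Fin n)) :
    cubeDist (signLinear A x) (signLinear A y) =
      (∑ k, signDiff x y (WithLp.toLp 2 (A k))) / m := by
  have h : ∀ (z : EuclideanSpace ℝ (Fin n)) (k : Fin m),
      A.mulVec z.ofLp k = inner ℝ z (WithLp.toLp 2 (A k)) := by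
    intro z k
    simp [Matrix.mulVec, dotProduct, PiLp.inner_apply]
  simp only [cubeDist, hammingDist, signLinear, signDiff, h, Finset.sum_boole]

/-- The indicator that `g` is nearly orthogonal to `y`. -/
noncomputable def slab (τ : ℝ) (y g : EuclideanSpace ℝ (Fin n)) : ℝ :=
  if |(inner ℝ y g : ℝ)| ≤ τ then 1 else 0

theorem slab_eq_indicator (τ : ℝ) (y : EuclideanSpace ℝ (Fin n)) :
    slab τ y = {g | |(inner ℝ y g : ℝ)| ≤ τ}.indicator 1 := by
  ext g; simp [slab, Set.indicator]

theorem measurableSet_slab (τ : ℝ) (y : EuclideanSpace ℝ (Fin n)) :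
    MeasurableSet {g : EuclideanSpace ℝ (Fin n) | |(inner ℝ y g : ℝ)| ≤ τ} := by
  have h : Measurable fun g : EuclideanSpace ℝ (Fin n) => |(inner ℝ y g : ℝ)| := by fun_prop
  exact measurableSet_le h measurable_const

theorem measurable_slab (τ : ℝ) (y : EuclideanSpace ℝ (Fin n)) : Measurable (slab τ y) := by
  rw [slab_eq_indicator]
  exact measurable_one.indicator (measurableSet_slab τ y)

theorem abs_slab_le_one (τ : ℝ) (y g : EuclideanSpace ℝ (Fin n)) : |slab τ y g| ≤ 1 := by
  unfold slab; split_ifs <;> simp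

theorem sq_slab (τ : ℝ) (y g : EuclideanSpace ℝ (Fin n)) : slab τ y g ^ 2 = slab τ y g := by
  unfold slab; split_ifs <;> simp

theorem integral_slab_le {τ : ℝ} (hτ : 0 ≤ τ) {y : EuclideanSpace ℝ (Fin n)} (hy : ‖y‖ = 1) :
    ∫ g, slab τ y g ∂stdGaussian (EuclideanSpace ℝ (Fin n)) ≤ τ := by
  rw [slab_eq_indicator, integral_indicator_one (measurableSet_slab τ y)]
  refine le_of_eq_of_le ?_ (gaussianReal_abs_le hτ)
  exact (hasLaw_inner_stdGaussian hy).measureReal_eq (p := fun t => |t| ≤ τ)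
    (measurableSet_le measurable_norm measurable_const)

/-- Outside the slab a sign change forces `|⟨x - y, g⟩| ≥ τ`. -/
theorem signDiff_le_slab_add {τ : ℝ} (hτ : 0 < τ) (x y g : EuclideanSpace ℝ (Fin n)) :
    signDiff x y g ≤ slab τ y g + (inner ℝ (x - y) g : ℝ) ^ 2 / τ ^ 2 := by
  have hq : 0 ≤ (inner ℝ (x - y) g : ℝ) ^ 2 / τ ^ 2 := by positivity
  by_cases hy : |(inner ℝ y g : ℝ)| ≤ τ
  · rw [slab, if_pos hy]
    linarith [signDiff_le_one x y g]
  rw [slab, if_neg hy, zero_add]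
  by_cases h : sgn (inner ℝ x g) ≠ sgn (inner ℝ y g)
  · rw [signDiff, if_pos h, one_le_div (by positivity), inner_sub_left]
    rw [sgn_ne_sgn_iff] at h
    push Not at hy
    rw [lt_abs] at hy
    rw [← sq_abs (inner ℝ x g - inner ℝ y g : ℝ)]
    refine pow_le_pow_left₀ hτ.le ?_ 2
    rw [le_abs]
    rcases h with ⟨h1, h2⟩ | ⟨h1, h2⟩ <;> rcases hy with h3 | h3 <;>
      first | (left; linarith) | (right; linarith)
  · rw [signDiff, if_neg h]
    exact hq

/-- A bound of the quadratic form `∑ ⟨z, a k⟩²` on a net bounds it on all sparse vectors. -/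
theorem sum_inner_sq_le_of_net {a : Fin m → EuclideanSpace ℝ (Fin n)}
    {N : Finset (EuclideanSpace ℝ (Fin n))} {B r : ℝ} (hr : r ≤ 1 / 2)
    (hnet : ∀ x ∈ sparseSphere n s, ∃ y ∈ N, ‖x - y‖ ≤ r ∧
      (Finset.univ.filter fun j => (x - y) j ≠ 0).card ≤ s)
    (hB : ∀ y ∈ N, ∑ k, (inner ℝ y (a k) : ℝ) ^ 2 ≤ B) {z : EuclideanSpace ℝ (Fin n)}
    (hz : (Finset.univ.filter fun j => z j ≠ 0).card ≤ s) :
    ∑ k, (inner ℝ z (a k) : ℝ) ^ 2 ≤ 4 * B * ‖z‖ ^ 2 := by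
  let T₀ : EuclideanSpace ℝ (Fin n) →ₗ[ℝ] EuclideanSpace ℝ (Fin m) :=
    { toFun := fun z => WithLp.toLp 2 fun k => (inner ℝ z (a k) : ℝ)
      map_add' := fun x y => by ext k; simp [inner_add_left]
      map_smul' := fun c x => by ext k; simp [inner_smul_left] }
  let T := LinearMap.toContinuousLinearMap T₀
  have hT : ∀ z, ‖T z‖ ^ 2 = ∑ k, (inner ℝ z (a k) : ℝ) ^ 2 := by
    intro z
    rw [EuclideanSpace.real_norm_sq_eq]
    rfl
  rcases eq_or_ne z 0 with rfl | hz0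
  · simp
  have hnormalize : ∀ w : EuclideanSpace ℝ (Fin n), w ≠ 0 →
      (Finset.univ.filter fun j => w j ≠ 0).card ≤ s → ‖w‖⁻¹ • w ∈ sparseSphere n s := by
    intro w hw hws
    refine ⟨by rw [norm_smul, norm_inv, norm_norm, inv_mul_cancel₀ (norm_ne_zero_iff.2 hw)], ?_⟩
    refine (Finset.card_le_card fun j hj => ?_).trans hws
    simp only [Finset.mem_filter, Finset.mem_univ, true_and] at hj ⊢
    intro h
    exact hj (by simp [h])
  set M := sSup ((fun w => ‖T w‖) '' sparseSphere n s) with hM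
  have hne : ((fun w => ‖T w‖) '' sparseSphere n s).Nonempty :=
    ⟨_, _, hnormalize z hz0 hz, rfl⟩
  have hbdd : BddAbove ((fun w => ‖T w‖) '' sparseSphere n s) := by
    refine ⟨‖T‖, ?_⟩
    rintro _ ⟨w, hw, rfl⟩
    simpa [hw.1] using T.le_opNorm w
  have hle : ∀ w ∈ sparseSphere n s, ‖T w‖ ≤ M := fun w hw => le_csSup hbdd ⟨w, hw, rfl⟩
  have hM0 : 0 ≤ M := (norm_nonneg _).trans (hle _ (hnormalize z hz0 hz))
  have hscale : ∀ w : EuclideanSpace ℝ (Fin n),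
      (Finset.univ.filter fun j => w j ≠ 0).card ≤ s → ‖T w‖ ≤ M * ‖w‖ := by
    intro w hws
    rcases eq_or_ne w 0 with rfl | hw
    · simp
    have h := hle _ (hnormalize w hw hws)
    rw [map_smul, norm_smul, norm_inv, norm_norm, inv_mul_le_iff₀ (norm_pos_iff.2 hw)] at h
    linarith
  have hMle : M ≤ 2 * √B := by
    -- Self-bounding of the sparse operator norm `M`: the approximation error is `s`-sparse of norm
    -- at most `1/2`, so `M` itself controls it. Finiteness of `M` allows absorbing `M / 2`.
    have : M ≤ √B + M / 2 := by
      refine csSup_le hne ?_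
      rintro _ ⟨x, hx, rfl⟩
      obtain ⟨y, hy, hxy, hxys⟩ := hnet x hx
      have h1 : ‖T y‖ ≤ √B := Real.le_sqrt_of_sq_le ((hT y).trans_le (hB y hy))
      have h2 : ‖T (x - y)‖ ≤ M * (1 / 2) :=
        (hscale _ hxys).trans (by gcongr; exact hxy.trans hr)
      have h3 : T x = T y + T (x - y) := by rw [← map_add]; simp
      calc ‖T x‖ ≤ ‖T y‖ + ‖T (x - y)‖ := by rw [h3]; exact norm_add_le _ _
        _ ≤ √B + M / 2 := by linarith
    linarith
  have hB0 : 0 ≤ B := by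
    obtain ⟨y, hy, -⟩ := hnet _ (hnormalize z hz0 hz)
    exact (Finset.sum_nonneg fun k _ => sq_nonneg _).trans (hB y hy)
  rw [← hT]
  calc ‖T z‖ ^ 2 ≤ (2 * √B * ‖z‖) ^ 2 := by
        gcongr
        exact (hscale z hz).trans (by gcongr)
    _ = 4 * B * ‖z‖ ^ 2 := by rw [mul_pow, mul_pow, Real.sq_sqrt hB0]; norm_num

/-- The deviation of the number of separating hyperplanes from its mean. -/
noncomputable def deviation (a : Fin m → EuclideanSpace ℝ (Fin n))
    (x y : EuclideanSpace ℝ (Fin n)) : ℝ :=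
  ∑ k, signDiff x y (a k) - m * geoDist x y

/-- With `δ = 4⁻ᴶ` the radius is `δ^(3/2)/256`. At slab width `δ/16` the slab and the quadratic term
`24 m ‖x - y‖² / (δ/16)²` each cost at most `m δ/8`. -/
theorem sum_signDiff_le_of_close {a : Fin m → EuclideanSpace ℝ (Fin n)} {J : ℕ}
    {x y : EuclideanSpace ℝ (Fin n)} (hxy : ‖x - y‖ ≤ (1 / 8) ^ J / 256)
    (hslab : ∑ k, slab ((1 / 4) ^ J / 16) y (a k) ≤ m * ((1 / 4) ^ J / 8))
    (hop : ∑ k, (inner ℝ (x - y) (a k) : ℝ) ^ 2 ≤ 24 * m * ‖x - y‖ ^ 2) :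
    ∑ k, signDiff x y (a k) ≤ m * ((1 / 4) ^ J / 4) := by
  set δ : ℝ := (1 / 4) ^ J with hδ
  have hδ0 : 0 < δ := by positivity
  have hτ : 0 < δ / 16 := by positivity
  have h1 : ∑ k, signDiff x y (a k) ≤ ∑ k, slab (δ / 16) y (a k) +
      (∑ k, (inner ℝ (x - y) (a k) : ℝ) ^ 2) / (δ / 16) ^ 2 := by
    rw [Finset.sum_div, ← Finset.sum_add_distrib]
    exact Finset.sum_le_sum fun k _ => signDiff_le_slab_add hτ x y (a k)
  have h2 : ‖x - y‖ ^ 2 ≤ δ ^ 3 / 65536 := by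
    calc ‖x - y‖ ^ 2 ≤ ((1 / 8) ^ J / 256) ^ 2 := by gcongr
      _ = δ ^ 3 / 65536 := by
          rw [hδ, div_pow, ← pow_mul, ← pow_mul, mul_comm J 2, mul_comm J 3, pow_mul, pow_mul]
          norm_num
  have h3 : (∑ k, (inner ℝ (x - y) (a k) : ℝ) ^ 2) / (δ / 16) ^ 2 ≤ m * (δ / 8) := by
    rw [div_le_iff₀ (by positivity)]
    calc ∑ k, (inner ℝ (x - y) (a k) : ℝ) ^ 2 ≤ 24 * m * ‖x - y‖ ^ 2 := hop
      _ ≤ 24 * m * (δ ^ 3 / 65536) := by gcongr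
      _ ≤ m * (δ / 8) * (δ / 16) ^ 2 := by
          have : 0 ≤ (m : ℝ) * δ ^ 3 := by positivity
          nlinarith
  linarith

/-- Chaining along nets of radius `8⁻ʲ / 256`, stopped at level `J`. -/
theorem abs_deviation_le_of_nets {a : Fin m → EuclideanSpace ℝ (Fin n)} {J : ℕ}
    {N : ℕ → Finset (EuclideanSpace ℝ (Fin n))} (hN : ∀ j, ∀ y ∈ N j, y ∈ sparseSphere n s)
    (hnet : ∀ j, ∀ x ∈ sparseSphere n s, ∃ y ∈ N j, ‖x - y‖ ≤ (1 / 8) ^ j / 256 ∧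
      (Finset.univ.filter fun i => (x - y) i ≠ 0).card ≤ s)
    (hbase : ∀ x ∈ N 0, ∀ y ∈ N 0, |deviation a x y| ≤ m * ((1 / 4) ^ J / 8))
    (hstep : ∀ j < J, ∀ x ∈ N j, ∀ y ∈ N j, ∀ x' ∈ N (j + 1), ∀ y' ∈ N (j + 1),
      ‖x' - x‖ ≤ (1 / 8) ^ j / 128 → ‖y' - y‖ ≤ (1 / 8) ^ j / 128 →
        |deviation a x' y' - deviation a x y| ≤ m * ((1 / 4) ^ J * (1 / 2) ^ j / 64))
    (hslab : ∀ y ∈ N J, ∑ k, slab ((1 / 4) ^ J / 16) y (a k) ≤ m * ((1 / 4) ^ J / 8))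
    (hop : ∀ z : EuclideanSpace ℝ (Fin n), (Finset.univ.filter fun i => z i ≠ 0).card ≤ s →
      ∑ k, (inner ℝ z (a k) : ℝ) ^ 2 ≤ 24 * m * ‖z‖ ^ 2)
    {x y : EuclideanSpace ℝ (Fin n)} (hx : x ∈ sparseSphere n s) (hy : y ∈ sparseSphere n s) :
    |deviation a x y| ≤ m * (1 / 4) ^ J := by
  choose! p hpN hpd hps using hnet
  have hm : (0 : ℝ) ≤ m := Nat.cast_nonneg m
  set δ : ℝ := (1 / 4) ^ J with hδ
  have hδ0 : 0 < δ := by positivity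
  have hclose : ∀ z ∈ sparseSphere n s, ∀ j, ‖p (j + 1) z - p j z‖ ≤ (1 / 8) ^ j / 128 := by
    intro z hz j
    have h1 := hpd j z hz
    have h2 := hpd (j + 1) z hz
    have h3 : ‖p (j + 1) z - p j z‖ ≤ ‖z - p (j + 1) z‖ + ‖z - p j z‖ := by
      rw [norm_sub_rev z (p (j + 1) z)]
      exact norm_sub_le_norm_sub_add_norm_sub _ _ _
    have h4 : (0 : ℝ) < (1 / 8) ^ j := by positivity
    rw [pow_succ] at h2
    linarith
  -- The increments `δ 2⁻ⁱ/64` over `i < j` sum to `δ/32 (1 - 2⁻ʲ)`, added to the base term `δ/8`.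
  have hind : ∀ j ≤ J, |deviation a (p j x) (p j y)| ≤
      m * (δ * (1 / 8 + 1 / 32 * (1 - (1 / 2) ^ j))) := by
    intro j
    induction j with
    | zero =>
      intro _
      refine (hbase _ (hpN 0 x hx) _ (hpN 0 y hy)).trans (le_of_eq ?_)
      rw [pow_zero]
      ring
    | succ j ih =>
      intro hj
      have h1 := ih (by omega)
      have h2 := hstep j (by omega) _ (hpN j x hx) _ (hpN j y hy) _ (hpN (j + 1) x hx) _
        (hpN (j + 1) y hy) (hclose x hx j) (hclose y hy j)
      have h3 := abs_sub_abs_le_abs_sub (deviation a (p (j + 1) x) (p (j + 1) y))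
        (deviation a (p j x) (p j y))
      rw [pow_succ]
      linarith
  have hJ := hind J le_rfl
  have hnorm : ∀ j, ∀ z ∈ sparseSphere n s, ‖p j z‖ = 1 := fun j z hz => (hN j _ (hpN j z hz)).1
  have hend : ∀ z ∈ sparseSphere n s, ∑ k, signDiff z (p J z) (a k) ≤ m * (δ / 4) := fun z hz =>
    sum_signDiff_le_of_close (hpd J z hz) (hslab _ (hpN J z hz)) (hop _ (hps J z hz))
  have hgeo : ∀ z ∈ sparseSphere n s, geoDist z (p J z) ≤ δ / 512 := by
    intro z hz
    have h1 := geoDist_le hz.1 (hnorm J z hz)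
    have h2 := hpd J z hz
    have h3 : (1 / 8 : ℝ) ^ J ≤ δ := pow_le_pow_left₀ (by norm_num) (by norm_num) J
    linarith
  have hdiff : |deviation a x y - deviation a (p J x) (p J y)| ≤
      m * (δ / 4) + m * (δ / 4) + m * (δ / 512 + δ / 512) := by
    have h1 : |∑ k, signDiff x y (a k) - ∑ k, signDiff (p J x) (p J y) (a k)| ≤
        m * (δ / 4) + m * (δ / 4) := by
      rw [← Finset.sum_sub_distrib]
      refine (Finset.abs_sum_le_sum_abs _ _).trans ((Finset.sum_le_sum fun k _ =>
        abs_signDiff_sub_le x y (p J x) (p J y) (a k)).trans ?_)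
      rw [Finset.sum_add_distrib]
      exact add_le_add (hend x hx) (hend y hy)
    have h2 : |m * geoDist x y - m * geoDist (p J x) (p J y)| ≤ m * (δ / 512 + δ / 512) := by
      rw [← mul_sub, abs_mul, abs_of_nonneg hm]
      gcongr
      exact (abs_geoDist_sub_le hx.1 hy.1 (hnorm J x hx) (hnorm J y hy)).trans
        (add_le_add (hgeo x hx) (hgeo y hy))
    have h3 : deviation a x y - deviation a (p J x) (p J y) =
      (∑ k, signDiff x y (a k) - ∑ k, signDiff (p J x) (p J y) (a k)) -
        (m * geoDist x y - m * geoDist (p J x) (p J y)) := by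
      unfold deviation; ring
    rw [h3]
    exact (abs_sub _ _).trans (add_le_add h1 h2)
  have h4 := abs_sub_abs_le_abs_sub (deviation a x y) (deviation a (p J x) (p J y))
  have h5 : 0 ≤ (m : ℝ) * δ * (1 / 2) ^ J := by positivity
  have h6 : 0 ≤ (m : ℝ) * δ := by positivity
  linarith

end Chaining

/-! ### Tail bounds for the individual events -/

section Probability

variable {Ω : Type*} [MeasurableSpace Ω] {P : Measure Ω} {m n s : ℕ}
  {X : Fin m → Ω → EuclideanSpace ℝ (Fin n)}

theorem measureReal_biUnion_le_card_mul {ι : Type*} (N : Finset ι) (f : ι → Set Ω) {b : ℝ}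
    (hb : ∀ i ∈ N, P.real (f i) ≤ b) : P.real (⋃ i ∈ N, f i) ≤ N.card * b := by
  refine (measureReal_biUnion_finset_le N f).trans ?_
  simpa using Finset.sum_le_sum hb

variable [IsProbabilityMeasure P]

theorem measureReal_deviation_le (hlaw : ∀ k, HasLaw (X k) (stdGaussian _) P)
    (hind : iIndepFun X P) {x y : EuclideanSpace ℝ (Fin n)} (hx : ‖x‖ = 1) (hy : ‖y‖ = 1) {t : ℝ}
    (ht : 0 ≤ t) (ht2 : t ≤ 2) :
    P.real {ω | m * t ≤ |deviation (fun k => X k ω) x y|} ≤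
      2 * Real.exp (-(m * (t ^ 2 / 4))) := by
  have h := measureReal_abs_sum_centred_ge_le hlaw hind (measurable_signDiff x y)
    (fun g => by rw [abs_of_nonneg (signDiff_nonneg x y g)]; exact signDiff_le_one x y g)
    (v := 1) (t := t) ?_ one_pos ht (by linarith)
  · rw [integral_signDiff_eq_geoDist hx hy] at h
    simpa [deviation] using h
  · calc ∫ g, signDiff x y g ^ 2 ∂stdGaussian _ ≤
        ∫ _g, (1 : ℝ) ∂stdGaussian (EuclideanSpace ℝ (Fin n)) := by
          simp_rw [sq_signDiff]
          exact integral_mono (integrable_signDiff x y) (integrable_const 1)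
            (signDiff_le_one x y)
      _ = 1 := by simp

theorem measureReal_deviation_sub_le (hlaw : ∀ k, HasLaw (X k) (stdGaussian _) P)
    (hind : iIndepFun X P) {x y x' y' : EuclideanSpace ℝ (Fin n)} (hx : ‖x‖ = 1) (hy : ‖y‖ = 1)
    (hx' : ‖x'‖ = 1) (hy' : ‖y'‖ = 1) {t v : ℝ} (hxv : ‖x' - x‖ ≤ v) (hyv : ‖y' - y‖ ≤ v)
    (hv : 0 < v) (ht : 0 ≤ t) (htv : t ≤ 2 * v) :
    P.real {ω | m * t ≤ |deviation (fun k => X k ω) x' y' - deviation (fun k => X k ω) x y|} ≤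
      2 * Real.exp (-(m * (t ^ 2 / (4 * v)))) := by
  have h := measureReal_abs_sum_centred_ge_le hlaw hind
    (f := fun g => signDiff x' y' g - signDiff x y g)
    ((measurable_signDiff x' y').sub (measurable_signDiff x y))
    (abs_signDiff_sub_le_one x' y' x y) (v := v) (t := t) ?_ hv ht htv
  · rw [integral_sub (integrable_signDiff x' y') (integrable_signDiff x y),
      integral_signDiff_eq_geoDist hx hy, integral_signDiff_eq_geoDist hx' hy'] at h
    refine le_of_eq_of_le ?_ h
    congr 2 with ω
    rw [Finset.sum_sub_distrib]
    simp only [deviation]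
    ring_nf
  · have hle : ∀ g, (signDiff x' y' g - signDiff x y g) ^ 2 ≤ signDiff x' x g + signDiff y' y g :=
      sq_signDiff_sub_le x' y' x y
    calc ∫ g, (signDiff x' y' g - signDiff x y g) ^ 2 ∂stdGaussian _
        ≤ ∫ g, (signDiff x' x g + signDiff y' y g) ∂stdGaussian _ :=
          integral_mono_of_nonneg (ae_of_all _ fun g => sq_nonneg _)
            ((integrable_signDiff x' x).add (integrable_signDiff y' y)) (ae_of_all _ hle)
      _ = geoDist x' x + geoDist y' y := by
          rw [integral_add (integrable_signDiff x' x) (integrable_signDiff y' y),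
            integral_signDiff_eq_geoDist hx' hx, integral_signDiff_eq_geoDist hy' hy]
      -- Each geodesic distance is at most half the chord, so the two together give `v`.
      _ ≤ v := by linarith [geoDist_le hx' hx, geoDist_le hy' hy]

/-- Bernstein with deviation and second moment both `τ`, so the exponent is linear in `τ` and not
quadratic. -/
theorem measureReal_slab_le (hlaw : ∀ k, HasLaw (X k) (stdGaussian _) P)
    (hind : iIndepFun X P) {y : EuclideanSpace ℝ (Fin n)} (hy : ‖y‖ = 1) {τ : ℝ} (hτ : 0 < τ) :
    P.real {ω | m * (2 * τ) ≤ ∑ k, slab τ y (X k ω)} ≤ Real.exp (-(m * (τ / 4))) := by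
  have hI := integral_slab_le hτ.le hy
  have h := measureReal_sum_centred_ge_le hlaw hind (measurable_slab τ y) (abs_slab_le_one τ y)
    (v := τ) (t := τ) (by simpa only [sq_slab] using hI) hτ hτ.le (by linarith)
  rw [show τ ^ 2 / (4 * τ) = τ / 4 by field_simp] at h
  refine (measureReal_mono fun ω hω => ?_).trans h
  simp only [Set.mem_ofPred_eq] at hω ⊢
  have : (m : ℝ) * ∫ g, slab τ y g ∂stdGaussian _ ≤ m * τ := by gcongr
  linarith

theorem measureReal_sum_inner_sq_le (hlaw : ∀ k, HasLaw (X k) (stdGaussian _) P)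
    (hind : iIndepFun X P) {y : EuclideanSpace ℝ (Fin n)} (hy : ‖y‖ = 1) :
    P.real {ω | (6 * m : ℝ) ≤ ∑ k, (inner ℝ y (X k ω) : ℝ) ^ 2} ≤ Real.exp (-m) := by
  have hl := hasLaw_inner_stdGaussian hy
  obtain ⟨hi, hb⟩ := exp_sq_div_four_gaussianReal
  have hm : Measurable fun g : EuclideanSpace ℝ (Fin n) => (inner ℝ y g : ℝ) ^ 2 / 4 := by fun_prop
  have hint : Integrable (fun g : EuclideanSpace ℝ (Fin n) =>
      Real.exp ((inner ℝ y g : ℝ) ^ 2 / 4)) (stdGaussian _) := by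
    rw [← hl.map_eq] at hi
    exact (integrable_map_measure hi.aestronglyMeasurable hl.aemeasurable).1 hi
  have hbd : ∫ g, Real.exp ((inner ℝ y g : ℝ) ^ 2 / 4) ∂stdGaussian _ ≤ Real.exp (1 / 2) :=
    (hl.integral_comp hi.aestronglyMeasurable).trans_le hb
  have h := measureReal_sum_ge_le_of_integral_exp_le hlaw hind hm hint hbd (6 * m / 4)
  rw [show (m : ℝ) * (1 / 2) - 6 * m / 4 = -m by ring] at h
  refine (measureReal_mono fun ω hω => ?_).trans h
  simp only [Set.mem_ofPred_eq] at hω ⊢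
  rw [← Finset.sum_div]
  linarith

/-- The complement of a measurable hull of `bad` serves as the event, so `bad` need not be
measurable. -/
theorem ripWithProb_of_measureReal_le {A : Ω → Matrix (Fin m) (Fin n) ℝ} {δ ε : ℝ} (bad : Set Ω)
    (hbad : P.real bad ≤ ε)
    (h : ∀ ω ∉ bad, HasRIP s δ (fun x : sparseSphere n s => signLinear (A ω) x.1)) :
    RIPWithProb A P s δ ε := by
  refine ⟨(toMeasurable P bad)ᶜ, (measurableSet_toMeasurable P bad).compl, ?_,
    fun ω hω => h ω fun hb => hω (subset_toMeasurable P bad hb)⟩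
  rw [ENNReal.ofReal_le_iff_le_toReal (measure_ne_top _ _), ← measureReal_def,
    probReal_compl_eq_one_sub (measurableSet_toMeasurable P bad), measureReal_def,
    measure_toMeasurable, ← measureReal_def]
  linarith

end Probability

/-! ### Entropy of the nets and the union bound -/

section Counting

theorem one_le_log_exp_mul_div {n s : ℕ} (hs : 1 ≤ s) (hsn : s ≤ n) :
    1 ≤ Real.log (Real.exp 1 * n / s) := by
  have hs0 : (0 : ℝ) < s := by exact_mod_cast hs
  have hsn' : (s : ℝ) ≤ n := by exact_mod_cast hsn
  have hn0 : (0 : ℝ) < n := hs0.trans_le hsn'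
  rw [Real.le_log_iff_exp_le (by positivity), le_div_iff₀ hs0]
  gcongr

/-- The net of radius `8⁻ʲ / 256`, with its cardinality bounded through the complexity `D`. -/
theorem exists_net_level {n s : ℕ} (hs : 1 ≤ s) (hsn : s ≤ n) {D : ℝ}
    (hD : s * Real.log (Real.exp 1 * n / s) ≤ D) (j : ℕ) :
    ∃ N : Finset (EuclideanSpace ℝ (Fin n)), (∀ y ∈ N, y ∈ sparseSphere n s) ∧
      (N.card : ℝ) ≤ Real.exp (D * (8 + 3 * j)) ∧
      ∀ x ∈ sparseSphere n s, ∃ y ∈ N, ‖x - y‖ ≤ (1 / 8) ^ j / 256 ∧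
        (Finset.univ.filter fun i => (x - y) i ≠ 0).card ≤ s := by
  have hr1 : (1 / 8 : ℝ) ^ j / 256 ≤ 1 := by
    have : (1 / 8 : ℝ) ^ j ≤ 1 := pow_le_one₀ (by norm_num) (by norm_num)
    linarith
  obtain ⟨N, h1, h2, h3⟩ := exists_net_sparseSphere (r := (1 / 8 : ℝ) ^ j / 256) hs hsn
    (by positivity) hr1
  refine ⟨N, h1, h2.trans (Real.exp_le_exp.2 ?_), h3⟩
  have hs0 : (0 : ℝ) < s := by exact_mod_cast hs
  have hlog1 := one_le_log_exp_mul_div hs hsn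
  have hlog2 : Real.log (3 / ((1 / 8) ^ j / 256)) ≤ 7 + 3 * j := by
    have hEq : (3 : ℝ) / ((1 / 8) ^ j / 256) = 768 * 8 ^ j := by
      rw [div_pow, one_pow]; field_simp; norm_num
    rw [hEq, Real.log_le_iff_le_exp (by positivity), Real.exp_add]
    have he := Real.exp_one_gt_d9
    have h7 : Real.exp 7 = Real.exp 1 ^ 7 := by rw [← Real.exp_nat_mul]; norm_num
    have h3 : Real.exp (3 * j) = (Real.exp 1 ^ 3) ^ j := by
      rw [← pow_mul, ← Real.exp_nat_mul]; push_cast; ring_nf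
    rw [h7, h3]
    have hle : (2.7 : ℝ) ≤ Real.exp 1 := by linarith
    have ha : (768 : ℝ) ≤ Real.exp 1 ^ 7 :=
      le_trans (by norm_num) (pow_le_pow_left₀ (by norm_num) hle 7)
    have hb : (8 : ℝ) ≤ Real.exp 1 ^ 3 :=
      le_trans (by norm_num) (pow_le_pow_left₀ (by norm_num) hle 3)
    gcongr
  have hsD : (s : ℝ) ≤ D := le_trans (by nlinarith) hD
  calc s * Real.log (Real.exp 1 * n / s) + s * Real.log (3 / ((1 / 8) ^ j / 256))
      ≤ D + s * (7 + 3 * j) := by gcongr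
    _ ≤ D + D * (7 + 3 * j) := by gcongr
    _ = D * (8 + 3 * j) := by ring

end Counting

/-- Of the exponent `D * (a + 2 + i)`, the part `D * a` pays for the cardinality, one `D` for the
factor `2`, one for `ε / 2`, and the remaining `i` for the geometric weight. -/
theorem mul_two_mul_exp_neg_le {ε D a c e : ℝ} (hε : Real.exp (-D) ≤ ε / 2) (hD : 1 ≤ D)
    (hc : c ≤ Real.exp (D * a)) (i : ℕ) (he : D * (a + 2 + i) ≤ e) :
    c * (2 * Real.exp (-e)) ≤ ε / 2 * (1 / 2) ^ i := by
  have h2 : 2 ≤ Real.exp D := by linarith [Real.add_one_le_exp D]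
  have h3 : Real.exp (-D) ≤ 1 / 2 := by
    rw [Real.exp_neg, one_div]; gcongr
  calc c * (2 * Real.exp (-e))
      ≤ Real.exp (D * a) * (Real.exp D * Real.exp (-(D * (a + 2 + i)))) := by gcongr
    _ = Real.exp (-D) * Real.exp (-D) ^ i := by
        rw [← Real.exp_add, ← Real.exp_nat_mul, ← Real.exp_add, ← Real.exp_add]
        ring_nf
    _ ≤ ε / 2 * (1 / 2) ^ i := by
        have h0 : 0 ≤ ε / 2 := (Real.exp_pos _).le.trans hε
        gcongr

theorem succ_le_two_pow (j : ℕ) : (j : ℝ) + 1 ≤ 2 ^ j := by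
  exact_mod_cast Nat.lt_two_pow_self

/-! ### Assembly at dyadic accuracy and reduction of general `δ` -/

section Main

variable {Ω : Type*} [MeasurableSpace Ω] {P : Measure Ω} {m n s : ℕ}

theorem RIPWithProb.mono {A : Ω → Matrix (Fin m) (Fin n) ℝ} {δ δ' ε : ℝ}
    (h : RIPWithProb A P s δ ε) (hδ : δ ≤ δ') : RIPWithProb A P s δ' ε := by
  obtain ⟨E, hE, hP, hR⟩ := h
  exact ⟨E, hE, hP, fun ω hω x y => (hR ω hω x y).trans hδ⟩

variable [IsProbabilityMeasure P]

theorem ripWithProb_dyadic {A : Ω → Matrix (Fin m) (Fin n) ℝ} (hA : IsStdGaussianMatrix A P)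
    (hs : 1 ≤ s) (hsn : s ≤ n) {ε D : ℝ} (hε : Real.exp (-D) ≤ ε / 2) (hD : 1 ≤ D)
    (hsD : s * Real.log (Real.exp 1 * n / s) ≤ D) (J : ℕ)
    (hm : 6000 * D ≤ m * ((1 / 4) ^ J) ^ 2) :
    RIPWithProb A P s ((1 / 4) ^ J) ε := by
  choose N hN hcard hnet using exists_net_level hs hsn hsD
  set X : Fin m → Ω → EuclideanSpace ℝ (Fin n) := fun k ω => WithLp.toLp 2 (A ω k) with hX
  have hlaw : ∀ k, HasLaw (X k) (stdGaussian _) P := hA.hasLaw_row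
  have hind : iIndepFun X P := hA.indep_rows
  set δ : ℝ := (1 / 4) ^ J with hδ
  have hδ0 : 0 < δ := by positivity
  have hδ1 : δ ≤ 1 := pow_le_one₀ (by norm_num) (by norm_num)
  have hunit : ∀ j, ∀ y ∈ N j, ‖y‖ = 1 := fun j y hy => (hN j y hy).1
  have hm0 : (0 : ℝ) < m := by
    by_contra h
    have h0 : (m : ℝ) * δ ^ 2 ≤ 0 := mul_nonpos_of_nonpos_of_nonneg (not_lt.1 h) (sq_nonneg _)
    linarith
  have hε0 : 0 < ε := by linarith [Real.exp_pos (-D)]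
  let badBase : Set Ω := ⋃ q ∈ N 0 ×ˢ N 0,
    {ω | m * (δ / 8) ≤ |deviation (fun k => X k ω) q.1 q.2|}
  let badStep : ℕ → Set Ω := fun j => ⋃ q ∈ (N j ×ˢ N j) ×ˢ (N (j + 1) ×ˢ N (j + 1)),
    {ω | (‖q.2.1 - q.1.1‖ ≤ (1 / 8) ^ j / 128 ∧ ‖q.2.2 - q.1.2‖ ≤ (1 / 8) ^ j / 128) ∧
      m * (δ * (1 / 2) ^ j / 64) ≤ |deviation (fun k => X k ω) q.2.1 q.2.2 -
        deviation (fun k => X k ω) q.1.1 q.1.2|}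
  let badSlab : Set Ω := ⋃ y ∈ N J, {ω | m * (2 * (δ / 16)) ≤ ∑ k, slab (δ / 16) y (X k ω)}
  -- Level `0` suffices here, since the operator norm bound needs only a net of radius at most
  -- `1/2`.
  let badNorm : Set Ω := ⋃ y ∈ N 0, {ω | (6 * m : ℝ) ≤ ∑ k, (inner ℝ y (X k ω) : ℝ) ^ 2}
  have hcard0 : ((N 0).card : ℝ) ≤ Real.exp (D * 8) := by simpa using hcard 0
  have hBase : P.real badBase ≤ ε / 2 * (1 / 2) ^ 1 := by
    refine (measureReal_biUnion_le_card_mul _ _ fun q hq => measureReal_deviation_le hlaw hind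
      (hunit 0 _ (Finset.mem_product.1 hq).1) (hunit 0 _ (Finset.mem_product.1 hq).2)
      (by positivity) (by linarith)).trans ?_
    refine mul_two_mul_exp_neg_le (a := 16) hε hD ?_ 1 ?_
    · rw [Finset.card_product, Nat.cast_mul, show D * 16 = D * 8 + D * 8 by ring, Real.exp_add]
      gcongr
    · rw [show (m : ℝ) * ((δ / 8) ^ 2 / 4) = m * δ ^ 2 / 256 by ring]
      push_cast
      linarith
  have hStep : ∀ j ∈ Finset.range J, P.real (badStep j) ≤ ε / 2 * (1 / 2) ^ (j + 2) := by
    intro j hj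
    have hjJ : j < J := Finset.mem_range.1 hj
    have hδj : δ * 4 ^ j ≤ 1 := by
      have h1 : δ ≤ (1 / 4) ^ j := pow_le_pow_of_le_one (by norm_num) (by norm_num) hjJ.le
      calc δ * 4 ^ j ≤ (1 / 4) ^ j * 4 ^ j := by gcongr
        _ = 1 := by rw [← mul_pow]; norm_num
    have hexp : (δ * (1 / 2) ^ j / 64) ^ 2 / (4 * ((1 / 8) ^ j / 128)) = δ ^ 2 * 2 ^ j / 128 := by
      have h1 : ((1 / 2 : ℝ) ^ j) ^ 2 = (1 / 8) ^ j * 2 ^ j := by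
        rw [← pow_mul, mul_comm, pow_mul, ← mul_pow]; norm_num
      rw [div_pow, mul_pow, h1]
      field_simp
      norm_num
    -- Bernstein's range condition amounts to `δ 4ʲ ≤ 1`, which holds up to the stopping level `J`.
    have htv : δ * (1 / 2) ^ j / 64 ≤ 2 * ((1 / 8) ^ j / 128) := by
      have h1 : (1 / 2 : ℝ) ^ j = 4 ^ j * (1 / 8) ^ j := by rw [← mul_pow]; norm_num
      have h2 : (0 : ℝ) < (1 / 8) ^ j := by positivity
      rw [h1]
      nlinarith
    refine (measureReal_biUnion_le_card_mul (b := 2 * Real.exp (-(m * (δ ^ 2 * 2 ^ j / 128))))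
      _ _ fun q hq => ?_).trans ?_
    · simp only [Finset.mem_product] at hq
      by_cases hc : ‖q.2.1 - q.1.1‖ ≤ (1 / 8) ^ j / 128 ∧ ‖q.2.2 - q.1.2‖ ≤ (1 / 8) ^ j / 128
      · simp only [hc, and_self, true_and]
        rw [← hexp]
        exact measureReal_deviation_sub_le hlaw hind (hunit _ _ hq.1.1) (hunit _ _ hq.1.2)
          (hunit _ _ hq.2.1) (hunit _ _ hq.2.2) hc.1 hc.2 (by positivity) (by positivity) htv
      · simp only [hc, false_and]
        simp only [Set.ofPred_false, measureReal_empty]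
        positivity
    -- Four net points are chosen: `2 (8 + 3j) + 2 (8 + 3(j + 1)) = 38 + 12j`. The weight `j + 2`
    -- makes all the steps together cost at most `ε/4`, as much as each of the other three events.
    · refine mul_two_mul_exp_neg_le (a := 38 + 12 * j) hε hD ?_ (j + 2) ?_
      · have h1 := hcard j
        have h2 := hcard (j + 1)
        simp only [Finset.card_product, Nat.cast_mul]
        calc ((N j).card : ℝ) * (N j).card * ((N (j + 1)).card * (N (j + 1)).card)
            ≤ Real.exp (D * (8 + 3 * j)) * Real.exp (D * (8 + 3 * j)) *
              (Real.exp (D * (8 + 3 * (j + 1 : ℕ))) * Real.exp (D * (8 + 3 * (j + 1 : ℕ)))) := by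
              gcongr
          _ = Real.exp (D * (38 + 12 * j)) := by
              rw [← Real.exp_add, ← Real.exp_add, ← Real.exp_add]
              push_cast
              ring_nf
      · have h1 := succ_le_two_pow j
        push_cast
        calc D * (38 + 12 * j + 2 + (j + 2)) ≤ D * (46 * 2 ^ j) := by
              gcongr
              have : (0 : ℝ) ≤ j := Nat.cast_nonneg j
              linarith
          _ ≤ (6000 * D) * 2 ^ j / 128 := by
              have : 0 < D * 2 ^ j := by positivity
              linarith
          _ ≤ (m * δ ^ 2) * 2 ^ j / 128 := by gcongr
          _ = m * (δ ^ 2 * 2 ^ j / 128) := by ring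
  have hSlab : P.real badSlab ≤ ε / 2 * (1 / 2) ^ 1 := by
    refine (measureReal_biUnion_le_card_mul (b := 2 * Real.exp (-(m * (δ / 16 / 4)))) _ _
      fun y hy => (measureReal_slab_le hlaw hind (hunit J y hy) (by positivity)).trans
        (by linarith [Real.exp_pos (-(m * (δ / 16 / 4)))])).trans ?_
    refine mul_two_mul_exp_neg_le hε hD (hcard J) 1 ?_
    have h1 := succ_le_two_pow J
    -- The slab exponent is linear in `δ`, hence equals `m δ² 4ᴶ/64`; the factor `4ᴶ` beats the
    -- entropy of the finest net, linear in `J`.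
    have h2 : δ * 4 ^ J = 1 := by rw [hδ, ← mul_pow]; norm_num
    have h3 : (2 : ℝ) ^ J ≤ 4 ^ J := pow_le_pow_left₀ (by norm_num) (by norm_num) J
    have hJ0 : (0 : ℝ) ≤ J := Nat.cast_nonneg J
    push_cast
    calc D * (8 + 3 * J + 2 + 1) ≤ D * (11 * 4 ^ J) := by gcongr; linarith
      _ ≤ (6000 * D) * 4 ^ J / 64 := by
          have : 0 < D * 4 ^ J := by positivity
          linarith
      _ ≤ (m * δ ^ 2) * 4 ^ J / 64 := by gcongr
      _ = m * (δ * (δ * 4 ^ J) / 64) := by ring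
      _ = m * (δ / 16 / 4) := by rw [h2]; ring
  have hNorm : P.real badNorm ≤ ε / 2 * (1 / 2) ^ 1 := by
    refine (measureReal_biUnion_le_card_mul (b := 2 * Real.exp (-m)) _ _
      fun y hy => (measureReal_sum_inner_sq_le hlaw hind (hunit 0 y hy)).trans
        (by linarith [Real.exp_pos (-(m : ℝ))])).trans ?_
    refine mul_two_mul_exp_neg_le hε hD hcard0 1 ?_
    have h1 : (m : ℝ) * δ ^ 2 ≤ m * 1 := by
      gcongr
      exact pow_le_one₀ hδ0.le hδ1
    push_cast
    linarith
  have hStepSum : P.real (⋃ j ∈ Finset.range J, badStep j) ≤ ε / 4 := by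
    refine (measureReal_biUnion_finset_le _ _).trans ((Finset.sum_le_sum hStep).trans ?_)
    have hgeom : ∑ j ∈ Finset.range J, (1 / 2 : ℝ) ^ j ≤ 2 := by
      have := geom_sum_eq (x := (1 / 2 : ℝ)) (by norm_num) J
      rw [this]
      have hp : (0 : ℝ) < (1 / 2) ^ J := by positivity
      rw [div_le_iff_of_neg (by norm_num)]
      linarith
    calc ∑ j ∈ Finset.range J, ε / 2 * (1 / 2 : ℝ) ^ (j + 2)
        = ε / 8 * ∑ j ∈ Finset.range J, (1 / 2 : ℝ) ^ j := by
          rw [Finset.mul_sum]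
          refine Finset.sum_congr rfl fun j _ => ?_
          rw [pow_add]; ring
      _ ≤ ε / 8 * 2 := by gcongr
      _ = ε / 4 := by ring
  refine ripWithProb_of_measureReal_le
    (badBase ∪ (⋃ j ∈ Finset.range J, badStep j) ∪ badSlab ∪ badNorm) ?_ fun ω hω => ?_
  · have h1 := measureReal_union_le (μ := P)
      (badBase ∪ (⋃ j ∈ Finset.range J, badStep j) ∪ badSlab) badNorm
    have h2 := measureReal_union_le (μ := P)
      (badBase ∪ (⋃ j ∈ Finset.range J, badStep j)) badSlab
    have h3 := measureReal_union_le (μ := P) badBase (⋃ j ∈ Finset.range J, badStep j)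
    linarith
  · simp only [Set.mem_union, not_or] at hω
    obtain ⟨⟨⟨hω1, hω2⟩, hω3⟩, hω4⟩ := hω
    simp only [badBase, badStep, badSlab, badNorm, Set.mem_iUnion, Set.mem_ofPred_eq, not_exists,
      Finset.mem_product, Finset.mem_range, not_and, not_le, and_imp, Prod.forall]
      at hω1 hω2 hω3 hω4
    have hop : ∀ z : EuclideanSpace ℝ (Fin n), (Finset.univ.filter fun i => z i ≠ 0).card ≤ s →
        ∑ k, (inner ℝ z (X k ω) : ℝ) ^ 2 ≤ 24 * m * ‖z‖ ^ 2 := by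
      intro z hz
      refine (sum_inner_sq_le_of_net (r := (1 / 8) ^ 0 / 256) (by norm_num) (hnet 0)
        (fun y hy => (hω4 y hy).le) hz).trans (le_of_eq ?_)
      ring
    intro x y
    have hdev := abs_deviation_le_of_nets (a := fun k => X k ω) (J := J) hN hnet
      (fun x hx y hy => (hω1 x y hx hy).le)
      (fun j hj x hx y hy x' hx' y' hy' h1 h2 =>
        (hω2 j hj x y x' y' hx hy hx' hy' h1 h2).le)
      (fun y hy => (hω3 y hy).le.trans (le_of_eq (by ring))) hop x.2 y.2
    rw [cubeDist_signLinear]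
    have heq : (∑ k, signDiff x.1 y.1 (WithLp.toLp 2 (A ω k))) / m - geoDist x.1 y.1 =
        deviation (fun k => X k ω) x.1 y.1 / m := by
      rw [deviation, sub_div, mul_div_cancel_left₀ _ hm0.ne']
    rw [heq, abs_div, abs_of_pos hm0, div_le_iff₀ hm0]
    linarith

theorem ripWithProb_of_le {A : Ω → Matrix (Fin m) (Fin n) ℝ} (hA : IsStdGaussianMatrix A P)
    (hs : 1 ≤ s) (hsn : s ≤ n) {ε δ : ℝ} (hε : 0 < ε) (hε1 : ε < 1) (hδ : 0 < δ) (hδ1 : δ < 1)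
    (hm : 96000 * (δ ^ 2)⁻¹ * (Real.log (2 / ε) + s * Real.log (Real.exp 1 * n / s)) ≤ m) :
    RIPWithProb A P s δ ε := by
  set D := Real.log (2 / ε) + s * Real.log (Real.exp 1 * n / s) with hDdef
  have hs1 : (1 : ℝ) ≤ s := by exact_mod_cast hs
  have hL : 1 ≤ s * Real.log (Real.exp 1 * n / s) :=
    one_le_mul_of_one_le_of_one_le hs1 (one_le_log_exp_mul_div hs hsn)
  have hlogε : 0 ≤ Real.log (2 / ε) := Real.log_nonneg (by rw [le_div_iff₀ hε]; linarith)
  have hexp : Real.exp (-D) ≤ ε / 2 := by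
    calc Real.exp (-D) ≤ Real.exp (-Real.log (2 / ε)) := Real.exp_le_exp.2 (by linarith)
      _ = ε / 2 := by rw [Real.exp_neg, Real.exp_log (by positivity), inv_div]
  -- Rounding `δ` down to a power of `1/4` loses at most a factor `4`, so `96000 = 16 * 6000`.
  obtain ⟨k, hk1, hk2⟩ := exists_nat_pow_near_of_lt_one hδ hδ1.le
    (by norm_num : (0 : ℝ) < 1 / 4) (by norm_num)
  refine (ripWithProb_dyadic hA hs hsn hexp (by linarith) (by linarith) (k + 1) ?_).mono hk1.le
  have h1 : δ / 4 ≤ (1 / 4) ^ (k + 1) := by rw [pow_succ]; linarith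
  have h2 : 96000 * D ≤ m * δ ^ 2 := by
    rw [mul_assoc, mul_comm (δ ^ 2)⁻¹, ← mul_assoc, ← div_eq_mul_inv,
      div_le_iff₀ (by positivity)] at hm
    exact hm
  calc 6000 * D ≤ m * (δ / 4) ^ 2 := by linarith
    _ ≤ m * ((1 / 4) ^ (k + 1)) ^ 2 := by gcongr

end Main

end OneBit

/-! ### Both parts of the theorem -/

theorem theorem2p3 :
    (∃ C : ℝ, 0 < C ∧
      ∀ (m n s : ℕ) (ε δ : ℝ), 0 < ε → ε < 1 → 0 < δ → δ < 1 → 1 ≤ s → s < n →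
        C * (δ ^ 2)⁻¹ * (Real.log (2 / ε) + s * Real.log (Real.exp 1 * n / s)) ≤ m →
        ∀ (Ω : Type u) [MeasurableSpace Ω] (P : Measure Ω) [IsProbabilityMeasure P]
          (A : Ω → Matrix (Fin m) (Fin n) ℝ), OneBit.IsStdGaussianMatrix A P →
          OneBit.RIPWithProb A P s δ ε) ∧
    (∀ θ : ℝ, 0 < θ → θ < 1 → ∃ C : ℝ, 0 < C ∧
      ∀ (m n s : ℕ) (ε δ : ℝ), 0 < ε → ε < 1 → 0 < δ → δ < 1 → 1 ≤ s → (s : ℝ) ≤ θ * n →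
        C * (δ ^ 2)⁻¹ * (Real.log (2 / ε) + s * Real.log ((n : ℝ) / s)) ≤ m →
        ∀ (Ω : Type u) [MeasurableSpace Ω] (P : Measure Ω) [IsProbabilityMeasure P]
          (A : Ω → Matrix (Fin m) (Fin n) ℝ), OneBit.IsStdGaussianMatrix A P →
          OneBit.RIPWithProb A P s δ ε) := by
  refine ⟨⟨96000, by norm_num, ?_⟩, ?_⟩
  · intro m n s ε δ hε hε1 hδ hδ1 hs hsn hm Ω _ P _ A hA
    exact OneBit.ripWithProb_of_le hA hs hsn.le hε hε1 hδ hδ1 hm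
  · intro θ hθ hθ1
    have hl : 0 < Real.log (1 / θ) := Real.log_pos (by rw [lt_div_iff₀ hθ]; linarith)
    refine ⟨96000 * (1 + (Real.log (1 / θ))⁻¹), by positivity, ?_⟩
    intro m n s ε δ hε hε1 hδ hδ1 hs hsn hm Ω _ P _ A hA
    have hs0 : (0 : ℝ) < s := by exact_mod_cast hs
    have hn0 : (0 : ℝ) < n := by
      by_contra h
      nlinarith [not_lt.1 h]
    have hsn' : s ≤ n := by
      have : (s : ℝ) ≤ n := by nlinarith
      exact_mod_cast this
    refine OneBit.ripWithProb_of_le hA hs hsn' hε hε1 hδ hδ1 (le_trans ?_ hm)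
    have hlog : Real.log (1 / θ) ≤ Real.log ((n : ℝ) / s) := by
      refine Real.log_le_log (by positivity) ?_
      rw [div_le_div_iff₀ hθ hs0]
      linarith
    -- Since `n / s ≥ 1 / θ`, the extra `1` in `log (e n / s) = 1 + log (n / s)` is absorbed into a
    -- multiple of `log (n / s)`.
    have h1 : 1 ≤ (Real.log (1 / θ))⁻¹ * Real.log ((n : ℝ) / s) := by
      rwa [le_inv_mul_iff₀ hl, mul_one]
    have h2 : Real.log (Real.exp 1 * n / s) = 1 + Real.log ((n : ℝ) / s) := by
      rw [mul_div_assoc, Real.log_mul (Real.exp_pos 1).ne' (by positivity), Real.log_exp]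
    have hlogε : 0 ≤ Real.log (2 / ε) := Real.log_nonneg (by rw [le_div_iff₀ hε]; linarith)
    rw [h2]
    calc 96000 * (δ ^ 2)⁻¹ * (Real.log (2 / ε) + s * (1 + Real.log ((n : ℝ) / s)))
        ≤ 96000 * (δ ^ 2)⁻¹ * ((1 + (Real.log (1 / θ))⁻¹) *
          (Real.log (2 / ε) + s * Real.log ((n : ℝ) / s))) := by
          gcongr
          have h3 : 0 ≤ (Real.log (1 / θ))⁻¹ * Real.log (2 / ε) := by positivity
          have h4 : (s : ℝ) * 1 ≤ s * ((Real.log (1 / θ))⁻¹ * Real.log ((n : ℝ) / s)) := by gcongr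
          linarith
      _ = _ := by ring
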